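/- Let $R$ be a commutative ring with identity. **Conventions.** An ideal $I$ of $R$ is *dense* if $(0:_R I)=0$ and *semi-regular* if it contains a finitely generated dense ideal. $Q_0(R)$ is the ring of all $\alpha$ in the total quotient ring $T(R[x])$ of $R[x]$ such that $I\alpha\subseteq R$ for some finitely generated semi-regular ideal $I$. For an $R$-submodule $A$ of $Q_0(R)$ put $A^{-1}=\{x\in Q_0(R): xA\subseteq R\}$, $A_v=(A^{-1})^{-1}$ and $A_t=\bigcup B_v$, the union over the finitely generated $R$-submodules $B\subseteq A$ that contain a finitely generated dense ideal of $R$. An ideal $I$ is *$t$-invertible* if $(IJ)_t=R$ for some $R$-submodule $J$ of $Q_0(R)$. $R$ is a *$Q_0$-PvMR* if every finitely generated semi-regular ideal of $R$ is $t$-invertible. A *GV-ideal* is a finitely generated ideal $J$ such that the natural map $R\to \mathrm{Hom}_R(J,R)$ is an isomorphism. For an $R$-module $M$, $\mathrm{tor}_{GV}(M)=\{x\in M: Jx=0 \text{ for some GV-ideal } J\}$; $M$ is *GV-torsion* (*GV-torsion-free*) if $\mathrm{tor}_{GV}(M)=M$ ($=0$), and a *$w$-module* if it is GV-torsion-free and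 $\mathrm{Ext}^1_R(R/J,M)=0$ for all GV-ideals $J$. If $M$ is GV-torsion-free, with injective envelope $E(M)$, then $M_w=\{x\in E(M): Jx\subseteq M \text{ for some GV-ideal } J\}$; similarly, for an $R$-submodule $A$ of $Q_0(R)$, $A_w=\{x\in Q_0(R): Jx\subseteq A \text{ for some GV-ideal } J\}$. An ideal $I$ is *$w$-invertible* if $(II^{-1})_w=R$. A *maximal $w$-ideal* is an ideal that is maximal among the proper ideals of $R$ that are $w$-modules (such ideals are prime). A homomorphism is a *$w$-monomorphism* (*$w$-epimorphism*, *$w$-isomorphism*), respectively a sequence is *$w$-exact*, if its localization at every maximal $w$-ideal is injective (surjective, bijective), respectively exact. An $R$-module $M$ is: *of finite type* if there is a $w$-epimorphism onto $M$ from a finitely generated free module; *$w$-flat* if $-\otimes_R M$ preserves $w$-monomorphisms; *semi-regular $w$-flat* if $\mathrm{Tor}_1^R(R/I,M)$ is GV-torsion for every finitely generated semi-regular ideal $I$; *$w$-projective* if $\mathrm{Ext}^1_R((M/\mathrm{tor}_{GV}(M))_w,N)$ is GV-torsion for every torsion-free $w$-module $N$ (torsion-free: regular elements of $R$ act injectively);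 *semi-regular* if there are a positive integer $n$ and submodules $0=M_0\subseteq M_1\subseteq\cdots\subseteq M_n=M$ such that every $M_i/M_{i-1}$ is $w$-isomorphic to a semi-regular ideal of $R$. The dimension $sr\text{-}w\text{-}fd_R(M)\in\{0,1,\dots,\infty\}$ is the least $n$ for which there is a $w$-exact sequence $0\to F_n\to\cdots\to F_0\to M\to 0$ with $F_0,\dots,F_{n-1}$ $w$-flat and $F_n$ semi-regular $w$-flat ($\infty$ if there is none), and $sr\text{-}w\text{-}w.gl.dim(R)$ is the supremum of these over all $R$-modules $M$. **Theorem 4.4.** The following are equivalent. 1. $R$ is a $Q_0$-PvMR; equivalently, every finitely generated semi-regular ideal of $R$ is $w$-invertible. 2. Every submodule of a semi-regular $w$-flat $R$-module is semi-regular $w$-flat. 3. Every submodule of a $w$-flat $R$-module is semi-regular $w$-flat. 4. Every ideal of $R$ is semi-regular $w$-flat. 5. Every finitely generated (resp., finite type) ideal of $R$ is semi-regular $w$-flat. 6. Every finitely generated (resp., finite type) semi-regular ideal of $R$ is $w$-flat. 7. Every finitely generated (resp., finite type) semi-regular ideal of $R$ is $w$-projective. 8. $sr\text{-}w\text{-}w.gl.dim(R)\le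 1$. 9. Every finitely generated (resp., finite type) semi-regular $R$-module is $w$-projective. In 5, 6, 7 and 9 the "finitely generated" and the "finite type" versions are two separate conditions, each equivalent to all the others. -/

import Mathlib

open CategoryTheory

universe u

namespace WModule

section Ideals

variable (R : Type u) [CommRing R]

/-- A Glaz–Vasconcelos ideal: a finitely generated ideal `J` for which the natural map
`R → Hom_R(J, R)`, `r ↦ (x ↦ r x)`, is an isomorphism. -/
def IsGV (J : Ideal R) : Prop :=
  J.FG ∧ Function.Bijective (LinearMap.toSpanSingleton R (J →ₗ[R] R) J.subtype)

/-- An ideal `I` is dense if `(0 :_R I) = 0`. -/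
def IsDenseIdeal (I : Ideal R) : Prop :=
  ∀ r : R, (∀ x ∈ I, x * r = 0) → r = 0

/-- An ideal is semi-regular if it contains a finitely generated dense sub-ideal. -/
def IsSemiregularIdeal (I : Ideal R) : Prop :=
  ∃ D : Ideal R, D.FG ∧ IsDenseIdeal R D ∧ D ≤ I

variable {R}

theorem isGV_iff {J : Ideal R} : IsGV R J ↔ J.FG ∧ IsDenseIdeal R J ∧
    ∀ φ : J →ₗ[R] R, ∃ r : R, ∀ x : J, φ x = r * x := by
  unfold IsGV
  refine and_congr_right fun _ => and_congr ?_ ?_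
  · rw [injective_iff_map_eq_zero]
    refine forall_congr' fun r => ?_
    refine imp_congr_left ?_
    rw [LinearMap.ext_iff]
    simp [mul_comm]
  · refine forall_congr' fun φ => exists_congr fun r => ?_
    rw [LinearMap.ext_iff]
    simp [eq_comm]

theorem isGV_top : IsGV R (⊤ : Ideal R) := by
  refine isGV_iff.2 ⟨⟨{1}, by simp⟩, fun r h => by simpa using h 1 trivial, fun φ => ?_⟩
  refine ⟨φ ⟨1, trivial⟩, fun x => ?_⟩
  have h := φ.map_smul (x : R) ⟨1, trivial⟩
  rw [smul_eq_mul, mul_comm] at h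
  rw [← h]
  congr 1
  ext
  simp

theorem IsDenseIdeal.mul {I J : Ideal R} (hI : IsDenseIdeal R I) (hJ : IsDenseIdeal R J) :
    IsDenseIdeal R (I * J) := by
  intro r h
  refine hI r fun x hx => hJ _ fun y hy => ?_
  rw [← mul_assoc, mul_comm y x]
  exact h _ (Ideal.mul_mem_mul hx hy)

theorem IsGV.mul {I J : Ideal R} (hI : IsGV R I) (hJ : IsGV R J) : IsGV R (I * J) := by
  rw [isGV_iff] at *
  obtain ⟨hI1, hI2, hI3⟩ := hI
  obtain ⟨hJ1, hJ2, hJ3⟩ := hJ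
  refine ⟨hI1.mul hJ1, hI2.mul hJ2, fun φ => ?_⟩
  have key : ∀ x : I, ∃ r : R, ∀ y : J,
      φ ⟨x * y, Ideal.mul_mem_mul x.2 y.2⟩ = r * y := by
    intro x
    let ψ : J →ₗ[R] R :=
      { toFun := fun y => φ ⟨x * y, Ideal.mul_mem_mul x.2 y.2⟩
        map_add' := fun y z => by
          rw [← map_add]; congr 1; ext; simp [mul_add]
        map_smul' := fun c y => by
          rw [RingHom.id_apply, ← map_smul]; congr 1; ext; simp [mul_left_comm] }
    exact hJ3 ψ
  choose g hg using key
  have uniq : ∀ a b : R, (∀ y : J, a * y = b * y) → a = b := by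
    intro a b h
    refine sub_eq_zero.1 (hJ2 _ fun y hy => ?_)
    have := h ⟨y, hy⟩
    simp only at this
    rw [mul_comm, sub_mul, this, sub_self]
  let G : I →ₗ[R] R :=
    { toFun := g
      map_add' := fun a b => uniq _ _ fun y => by
        rw [add_mul, ← hg, ← hg, ← hg, ← map_add]; congr 1; ext; simp [add_mul]
      map_smul' := fun c a => uniq _ _ fun y => by
        rw [RingHom.id_apply, smul_eq_mul, mul_assoc, ← hg, ← hg]
        refine (congrArg φ ?_).trans (φ.map_smul c _)
        ext; simp [mul_assoc] }
  obtain ⟨r, hr⟩ := hI3 G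
  refine ⟨r, fun z => ?_⟩
  obtain ⟨z, hz⟩ := z
  induction hz using Submodule.mul_induction_on' with
  | mem_mul_mem x hx y hy =>
    have h1 := hg ⟨x, hx⟩ ⟨y, hy⟩
    have h2 : g ⟨x, hx⟩ = r * x := hr ⟨x, hx⟩
    rw [h2, mul_assoc] at h1
    exact h1
  | add x hx y hy h1 h2 =>
    have : (⟨x + y, add_mem hx hy⟩ : (I * J : Ideal R)) = ⟨x, hx⟩ + ⟨y, hy⟩ := rfl
    rw [this, map_add, h1, h2]
    simp [mul_add]

end Ideals

section Modules

variable (R : Type u) [CommRing R]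

/-- For a submodule `N` of `E`, the submodule `{x ∈ E | J x ⊆ N for some GV-ideal J}`. -/
def gvClosure {E : Type u} [AddCommGroup E] [Module R E] (N : Submodule R E) :
    Submodule R E where
  carrier := {x | ∃ J : Ideal R, IsGV R J ∧ ∀ j ∈ J, j • x ∈ N}
  zero_mem' := ⟨⊤, isGV_top, fun j _ => by simp⟩
  add_mem' := by
    rintro x y ⟨I, hI, hx⟩ ⟨J, hJ, hy⟩
    refine ⟨I * J, hI.mul hJ, fun j hj => ?_⟩
    rw [smul_add]
    exact add_mem (hx j (Ideal.mul_le_left hj)) (hy j (Ideal.mul_le_right hj))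
  smul_mem' := by
    rintro c x ⟨J, hJ, hx⟩
    refine ⟨J, hJ, fun j hj => ?_⟩
    rw [smul_comm]
    exact N.smul_mem c (hx j hj)

variable (M : Type u) [AddCommGroup M] [Module R M]

/-- `tor_GV(M) = {x ∈ M | J x = 0 for some GV-ideal J}`. -/
def gvTor : Submodule R M := gvClosure R ⊥

theorem mem_gvTor {x : M} :
    x ∈ gvTor R M ↔ ∃ J : Ideal R, IsGV R J ∧ ∀ j ∈ J, j • x = 0 := Iff.rfl

/-- `M` is GV-torsion if `tor_GV(M) = M`. -/
def IsGVTorsion : Prop := gvTor R M = ⊤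

/-- `M` is GV-torsion-free if `tor_GV(M) = 0`. -/
def IsGVTorsionFree : Prop := gvTor R M = ⊥

/-- A `w`-module: GV-torsion-free with `Ext¹_R(R/J, M) = 0` for all GV-ideals `J`. -/
def IsWModule : Prop :=
  IsGVTorsionFree R M ∧ ∀ J : Ideal R, IsGV R J →
    Subsingleton (Abelian.Ext.{u} (ModuleCat.of R (R ⧸ J)) (ModuleCat.of R M) 1)

/-- A maximal `w`-ideal: an ideal which is maximal among the proper ideals of `R` that are
`w`-modules. -/
def IsMaximalWIdeal (m : Ideal R) : Prop :=
  Maximal (fun I : Ideal R => I ≠ ⊤ ∧ IsWModule R I) m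

end Modules

section WMaps

variable {R : Type u} [CommRing R]
variable {A B C : Type u} [AddCommGroup A] [Module R A] [AddCommGroup B] [Module R B]
  [AddCommGroup C] [Module R C]

/-- The localization `f_m : A_m → B_m` of an `R`-linear map at a prime ideal `m`. -/
noncomputable def locMap (m : Ideal R) [m.IsPrime] (f : A →ₗ[R] B) :
    LocalizedModule m.primeCompl A →ₗ[R] LocalizedModule m.primeCompl B :=
  IsLocalizedModule.map m.primeCompl (LocalizedModule.mkLinearMap m.primeCompl A)
    (LocalizedModule.mkLinearMap m.primeCompl B) f

/- In the next four definitions the binder `[m.IsPrime]` excludes nothing: every maximal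
`w`-ideal is prime. -/

/-- `f` is a `w`-monomorphism: `f_m` is injective for every maximal `w`-ideal `m`. -/
def IsWMono (f : A →ₗ[R] B) : Prop :=
  ∀ (m : Ideal R) [m.IsPrime], IsMaximalWIdeal R m → Function.Injective (locMap m f)

/-- `f` is a `w`-epimorphism: `f_m` is surjective for every maximal `w`-ideal `m`. -/
def IsWEpi (f : A →ₗ[R] B) : Prop :=
  ∀ (m : Ideal R) [m.IsPrime], IsMaximalWIdeal R m → Function.Surjective (locMap m f)

/-- `f` is a `w`-isomorphism: `f_m` is bijective for every maximal `w`-ideal `m`. -/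
def IsWIso (f : A →ₗ[R] B) : Prop :=
  ∀ (m : Ideal R) [m.IsPrime], IsMaximalWIdeal R m → Function.Bijective (locMap m f)

/-- `A → B → C` is `w`-exact: `A_m → B_m → C_m` is exact for every maximal `w`-ideal `m`. -/
def IsWExact (f : A →ₗ[R] B) (g : B →ₗ[R] C) : Prop :=
  ∀ (m : Ideal R) [m.IsPrime], IsMaximalWIdeal R m → Function.Exact (locMap m f) (locMap m g)

end WMaps

section Classes

variable (R : Type u) [CommRing R] (M : Type u) [AddCommGroup M] [Module R M]

/-- `M` is of finite type: there is a `w`-epimorphism onto `M` from a finitely generated free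
module. -/
def IsFiniteType : Prop :=
  ∃ (n : ℕ) (g : (Fin n → R) →ₗ[R] M), IsWEpi g

/-- `M` is `w`-flat: tensoring with `M` preserves `w`-monomorphisms. -/
def IsWFlat : Prop :=
  ∀ (A B : Type u) [AddCommGroup A] [Module R A] [AddCommGroup B] [Module R B]
    (f : A →ₗ[R] B), IsWMono f → IsWMono (f.rTensor M)

/-- `M` is semi-regular `w`-flat: `Tor₁^R(R/I, M)` is GV-torsion for every finitely generated
semi-regular ideal `I`. -/
def IsSrWFlat : Prop :=
  ∀ I : Ideal R, I.FG → IsSemiregularIdeal R I →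
    IsGVTorsion R
      (((Tor (ModuleCat.{u} R) 1).obj (ModuleCat.of R (R ⧸ I))).obj (ModuleCat.of R M))

/-- `M` has a semi-regular `w`-flat `w`-resolution of length `n`, that is, a `w`-exact sequence
`0 → F n → ⋯ → F 1 → F 0 → M → 0` with `F i` `w`-flat for `i < n` and `F n` semi-regular
`w`-flat. The sequence is continued to the left by zero modules. -/
def HasSrWFlatResolution (n : ℕ) : Prop :=
  ∃ (F : ℕ → ModuleCat.{u} R) (d : ∀ i, F (i + 1) →ₗ[R] F i) (ε : F 0 →ₗ[R] M),
    IsWEpi ε ∧ IsWExact (d 0) ε ∧ (∀ i, IsWExact (d (i + 1)) (d i)) ∧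
    (∀ i < n, IsWFlat R (F i)) ∧ IsSrWFlat R (F n) ∧ ∀ i, n < i → Subsingleton (F i)

/-- The semi-regular `w`-flat dimension: the length of a shortest semi-regular `w`-flat
`w`-resolution, and `⊤` if there is none. -/
noncomputable def srWFlatDim : ℕ∞ :=
  ⨅ (n : ℕ) (_ : HasSrWFlatResolution R M n), (n : ℕ∞)

/-- The `sr`-`w`-weak global dimension of `R`. -/
noncomputable def srWWeakGlobalDim : ℕ∞ :=
  ⨆ M : ModuleCat.{u} R, srWFlatDim R M

/-- `M` is a semi-regular module: it has a finite filtration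
`0 = c 0 ⊆ c 1 ⊆ ⋯ ⊆ c n = M`, with `n` positive, each of whose factors admits a
`w`-isomorphism to a semi-regular ideal of `R`. -/
def IsSemiregularModule : Prop :=
  ∃ (n : ℕ) (c : ℕ → Submodule R M), 0 < n ∧ c 0 = ⊥ ∧ c n = ⊤ ∧ Monotone c ∧
    ∀ i < n, ∃ (I : Ideal R) (f : (c (i + 1) ⧸ (c i).submoduleOf (c (i + 1))) →ₗ[R] I),
      IsSemiregularIdeal R I ∧ IsWIso f

end Classes

section Envelope

variable (R : Type u) [CommRing R]

/-- `i : M → E` is an injective envelope: `E` is injective, and `i` is an injective map whose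
range is an essential submodule. -/
structure IsInjectiveEnvelope {M E : Type u} [AddCommGroup M] [Module R M]
    [AddCommGroup E] [Module R E] (i : M →ₗ[R] E) : Prop where
  injective_module : Module.Injective R E
  injective_map : Function.Injective i
  essential : ∀ N : Submodule R E, N ⊓ LinearMap.range i = ⊥ → N = ⊥

theorem exists_injectiveEnvelope (M : Type u) [AddCommGroup M] [Module R M] :
    ∃ (E : ModuleCat.{u} R) (i : M →ₗ[R] E), IsInjectiveEnvelope R i := by
  obtain ⟨E, j, hE, hj⟩ : ∃ (E : ModuleCat.{u} R) (j : M →ₗ[R] E),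
      Module.Injective R E ∧ Function.Injective j := by
    obtain ⟨P⟩ := EnoughInjectives.presentation (ModuleCat.of R M)
    exact ⟨P.J, P.f.hom, (Module.injective_iff_injective_object R P.J).2 P.injective,
      (ModuleCat.mono_iff_injective P.f).1 P.mono⟩
  -- a maximal essential extension `N` of `M` inside `E`
  obtain ⟨N, hjN, hN⟩ := zorn_le_nonempty₀
    {N : Submodule R E | LinearMap.range j ≤ N ∧
      ∀ K ≤ N, K ⊓ LinearMap.range j = ⊥ → K = ⊥} (by
      intro c hc hchain N₀ hN₀
      refine ⟨sSup c, ⟨(hc hN₀).1.trans (le_sSup hN₀), fun K hK hKj => ?_⟩,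
        fun z hz => le_sSup hz⟩
      rw [eq_bot_iff]
      intro x hx
      obtain ⟨N₁, hN₁, hxN₁⟩ :=
        (Submodule.mem_sSup_of_directed ⟨N₀, hN₀⟩ hchain.directedOn).1 (hK hx)
      have := (hc hN₁).2 (K ⊓ N₁) inf_le_right (by
        rw [eq_bot_iff, ← hKj]
        exact inf_le_inf_right _ inf_le_left)
      rw [← this]
      exact ⟨hx, hxN₁⟩) (LinearMap.range j)
      ⟨le_rfl, fun K hK h => by rwa [inf_eq_left.2 hK] at h⟩
  obtain ⟨-, hNess⟩ := hN.prop
  -- a maximal submodule `K` of `E` that meets `N` trivially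
  obtain ⟨K, -, hK⟩ := zorn_le_nonempty₀ {K : Submodule R E | K ⊓ N = ⊥} (by
      intro c hc hchain K₀ hK₀
      refine ⟨sSup c, ?_, fun z hz => le_sSup hz⟩
      rw [Set.mem_ofPred_eq, eq_bot_iff]
      rintro x ⟨hx, hxN⟩
      obtain ⟨K₁, hK₁, hxK₁⟩ :=
        (Submodule.mem_sSup_of_directed ⟨K₀, hK₀⟩ hchain.directedOn).1 hx
      rw [← show K₁ ⊓ N = ⊥ from hc hK₁]
      exact ⟨hxK₁, hxN⟩) ⊥ (by simp)
  have hKN : K ⊓ N = ⊥ := hK.prop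
  have hq : Function.Injective (K.mkQ ∘ₗ N.subtype) := by
    rw [injective_iff_map_eq_zero]
    intro x hx
    have : (x : E) ∈ K ⊓ N := ⟨by simpa using hx, x.2⟩
    rw [hKN] at this
    exact Subtype.ext this
  obtain ⟨h, hh⟩ := hE.out (K.mkQ ∘ₗ N.subtype) hq N.subtype
  have hh' : ∀ x (hx : x ∈ N), h (K.mkQ x) = x := fun x hx => hh ⟨x, hx⟩
  -- `N` is essential in `E / K`
  have hess : ∀ L : Submodule R (E ⧸ K), (∀ x ∈ N, K.mkQ x ∈ L → x = 0) → L = ⊥ := by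
    intro L hL
    have h1 : L.comap K.mkQ ∈ {K : Submodule R E | K ⊓ N = ⊥} := by
      rw [Set.mem_ofPred_eq, eq_bot_iff]
      rintro x ⟨hx, hxN⟩
      exact hL x hxN hx
    have h2 : K ≤ L.comap K.mkQ := by
      intro x hx
      rw [Submodule.mem_comap, Submodule.mkQ_apply, (Submodule.Quotient.mk_eq_zero K).2 hx]
      exact L.zero_mem
    have h3 := hK.le_of_ge h1 h2
    rw [eq_bot_iff]
    intro y hy
    obtain ⟨x, rfl⟩ := K.mkQ_surjective y
    have : x ∈ K := h3 hy
    simpa using this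
  have hhinj : Function.Injective h := by
    rw [← LinearMap.ker_eq_bot]
    refine hess _ fun x hx hx' => ?_
    rw [LinearMap.mem_ker, hh' x hx] at hx'
    exact hx'
  have hNh : N ≤ LinearMap.range h := fun x hx => ⟨K.mkQ x, hh' x hx⟩
  have hrange : LinearMap.range h ≤ N := by
    refine hN.le_of_ge ⟨hjN.trans hNh, fun L hL hLj => ?_⟩ hNh
    have h1 : L ⊓ N = ⊥ := by
      refine hNess _ inf_le_right ?_
      rw [eq_bot_iff, ← hLj]
      exact inf_le_inf_right _ inf_le_left
    have h2 : L.comap h = ⊥ := by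
      refine hess _ fun x hx hx' => ?_
      rw [Submodule.mem_comap, hh' x hx] at hx'
      have : x ∈ L ⊓ N := ⟨hx', hx⟩
      rwa [h1] at this
    rw [eq_bot_iff]
    intro x hx
    obtain ⟨y, rfl⟩ := hL hx
    have : y ∈ L.comap h := hx
    rw [h2, Submodule.mem_bot] at this
    simp [this]
  let ρ : E →ₗ[R] N := (h ∘ₗ K.mkQ).codRestrict N fun x => hrange ⟨_, rfl⟩
  have hρ : ∀ x : N, ρ x = x := fun x => Subtype.ext (hh' x x.2)
  refine ⟨ModuleCat.of R N, j.codRestrict N fun x => hjN ⟨x, rfl⟩, ⟨⟨?_⟩, ?_, ?_⟩⟩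
  · intro X Y _ _ _ _ f hf g
    obtain ⟨g', hg'⟩ := hE.out f hf (N.subtype ∘ₗ g)
    refine ⟨ρ ∘ₗ g', fun x => ?_⟩
    have := hg' x
    simp only [LinearMap.comp_apply] at this ⊢
    rw [this]
    exact hρ _
  · intro x y hxy
    exact hj (congrArg Subtype.val hxy)
  · intro L hL
    have h1 : L.map N.subtype = ⊥ := by
      refine hNess _ (Submodule.map_subtype_le N L) ?_
      rw [eq_bot_iff]
      rintro _ ⟨⟨x, hx, rfl⟩, ⟨y, hy⟩⟩
      have : x ∈ L ⊓ LinearMap.range (j.codRestrict N fun x => hjN ⟨x, rfl⟩) :=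
        ⟨hx, ⟨y, Subtype.ext hy⟩⟩
      rw [hL] at this
      simpa using this
    exact Submodule.map_injective_of_injective N.injective_subtype (h1.trans (Submodule.map_bot _).symm)

/-- The injective envelope `E(M)`. -/
noncomputable def injectiveEnvelope (M : Type u) [AddCommGroup M] [Module R M] :
    ModuleCat.{u} R :=
  (exists_injectiveEnvelope R M).choose

/-- The inclusion `M → E(M)`. -/
noncomputable def toInjectiveEnvelope (M : Type u) [AddCommGroup M] [Module R M] :
    M →ₗ[R] injectiveEnvelope R M :=
  (exists_injectiveEnvelope R M).choose_spec.choose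

theorem isInjectiveEnvelope_toInjectiveEnvelope (M : Type u) [AddCommGroup M] [Module R M] :
    IsInjectiveEnvelope R (toInjectiveEnvelope R M) :=
  (exists_injectiveEnvelope R M).choose_spec.choose_spec

/-- The `w`-envelope `M_w = {x ∈ E(M) | J x ⊆ M for some GV-ideal J}`. -/
noncomputable def wEnvelope (M : Type u) [AddCommGroup M] [Module R M] :
    Submodule R (injectiveEnvelope R M) :=
  gvClosure R (LinearMap.range (toInjectiveEnvelope R M))

/-- `M` is `w`-projective: `Ext¹_R((M / tor_GV(M))_w, N)` is GV-torsion for every torsion-free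
`w`-module `N`. Torsion-free means that regular elements of `R` act injectively on `N`. -/
def IsWProjective (M : Type u) [AddCommGroup M] [Module R M] : Prop :=
  ∀ (N : Type u) [AddCommGroup N] [Module R N], Module.IsTorsionFree R N → IsWModule R N →
    IsGVTorsion R
      (Abelian.Ext.{u} (ModuleCat.of R (wEnvelope R (M ⧸ gvTor R M))) (ModuleCat.of R N) 1)

end Envelope

section FiniteFractions

variable (R : Type u) [CommRing R]

/-- The ring of finite fractions
`Q₀(R) = {α ∈ T(R[x]) | I α ⊆ R for some finitely generated semi-regular ideal I}`. -/
noncomputable def Q0 : Subalgebra R (FractionRing (Polynomial R)) where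
  carrier := {α | ∃ I : Ideal R, I.FG ∧ IsSemiregularIdeal R I ∧
    ∀ a ∈ I, ∃ r : R, a • α = algebraMap R (FractionRing (Polynomial R)) r}
  algebraMap_mem' r := ⟨⊤, isGV_top.1, ⟨⊤, isGV_top.1, (isGV_iff.1 isGV_top).2.1, le_rfl⟩,
    fun a _ => ⟨a * r, by rw [Algebra.smul_def, map_mul]⟩⟩
  add_mem' := by
    rintro α β ⟨I, hI, ⟨D, hD, hD', hDI⟩, hα⟩ ⟨J, hJ, ⟨G, hG, hG', hGJ⟩, hβ⟩
    refine ⟨I * J, hI.mul hJ, ⟨D * G, hD.mul hG, hD'.mul hG', Ideal.mul_mono hDI hGJ⟩,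
      fun a ha => ?_⟩
    obtain ⟨r, hr⟩ := hα a (Ideal.mul_le_left ha)
    obtain ⟨s, hs⟩ := hβ a (Ideal.mul_le_right ha)
    exact ⟨r + s, by rw [smul_add, hr, hs, map_add]⟩
  mul_mem' := by
    rintro α β ⟨I, hI, ⟨D, hD, hD', hDI⟩, hα⟩ ⟨J, hJ, ⟨G, hG, hG', hGJ⟩, hβ⟩
    refine ⟨I * J, hI.mul hJ, ⟨D * G, hD.mul hG, hD'.mul hG', Ideal.mul_mono hDI hGJ⟩,
      fun a ha => ?_⟩
    induction ha using Submodule.mul_induction_on' with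
    | mem_mul_mem x hx y hy =>
      obtain ⟨r, hr⟩ := hα x hx
      obtain ⟨s, hs⟩ := hβ y hy
      exact ⟨r * s, by rw [← smul_mul_smul_comm, hr, hs, map_mul]⟩
    | add x hx y hy h1 h2 =>
      obtain ⟨r, hr⟩ := h1
      obtain ⟨s, hs⟩ := h2
      exact ⟨r + s, by rw [add_smul, hr, hs, map_add]⟩

variable {R}

/-- An ideal of `R` as an `R`-submodule of `Q₀(R)`. -/
noncomputable def toQ0 (I : Ideal R) : Submodule R (Q0 R) :=
  Submodule.map (Algebra.linearMap R (Q0 R)) I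

/-- `A⁻¹ = {x ∈ Q₀(R) | x A ⊆ R}`. -/
noncomputable def q0Inv (A : Submodule R (Q0 R)) : Submodule R (Q0 R) where
  carrier := {x | ∀ y ∈ A, ∃ r : R, x * y = algebraMap R (Q0 R) r}
  zero_mem' := fun y _ => ⟨0, by simp⟩
  add_mem' := by
    intro a b ha hb y hy
    obtain ⟨r, hr⟩ := ha y hy
    obtain ⟨s, hs⟩ := hb y hy
    exact ⟨r + s, by rw [add_mul, hr, hs, map_add]⟩
  smul_mem' := by
    intro c a ha y hy
    obtain ⟨r, hr⟩ := ha y hy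
    exact ⟨c * r, by rw [smul_mul_assoc, hr, map_mul, Algebra.smul_def]⟩

/-- The `t`-closure of an `R`-submodule `A` of `Q₀(R)`: the union of `B_v = (B⁻¹)⁻¹` over the
finitely generated `R`-submodules `B ⊆ A` which are semi-regular, i.e. which contain a finitely
generated dense ideal of `R`. -/
def tClosure (A : Submodule R (Q0 R)) : Set (Q0 R) :=
  {x | ∃ B : Submodule R (Q0 R), B.FG ∧ B ≤ A ∧
    (∃ I : Ideal R, IsSemiregularIdeal R I ∧ toQ0 I ≤ B) ∧ x ∈ q0Inv (q0Inv B)}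

/-- An ideal `I` is `t`-invertible if `(I J)_t = R` for some `R`-submodule `J` of `Q₀(R)`. -/
def IsTInvertible (I : Ideal R) : Prop :=
  ∃ J : Submodule R (Q0 R), tClosure (toQ0 I * J) = Set.range (algebraMap R (Q0 R))

/-- An ideal `I` is `w`-invertible if `(I I⁻¹)_w = R`, with the `w`-closure taken in `Q₀(R)`. -/
def IsWInvertible (I : Ideal R) : Prop :=
  (gvClosure R (toQ0 I * q0Inv (toQ0 I)) : Set (Q0 R)) = Set.range (algebraMap R (Q0 R))

variable (R)

/-- `R` is a `Q₀`-PvMR: every finitely generated semi-regular ideal is `t`-invertible. -/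
def IsQ0PvMR : Prop :=
  ∀ I : Ideal R, I.FG → IsSemiregularIdeal R I → IsTInvertible I

end FiniteFractions

end WModule

/-!
Everything is governed by one property of a finitely generated dense ideal `I`: there is a GV-ideal
`J` such that, for `j ∈ J`, multiplication by `j` on `I` factors through a finitely generated free
module (`LinearMap.id ∈ gvFiniteRank R I I`). All conditions of the theorem are compared with this
one, imposed on all finitely generated semi-regular ideals `I`.

* The localizations at maximal `w`-ideals enter only through the local-global principle
  `mem_gvClosure_iff_forall_isMaximalWIdeal`: an element lies in the closure `N_w` of a submodule
  `N` if and only if it lies in `N` locally at every maximal `w`-ideal. So `w`-monomorphisms are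
  the maps with GV-torsion kernel, and so on.
* Homomorphisms `I → R` are multiplications by elements of `Q₀(R)`, so the elements of `I I⁻¹` are
  the multiplications on `I` that have finite rank. This gives the equivalence with
  `w`-invertibility (`isWInvertible_iff_id_mem`). If `(I J)_t = R`, then `I J` contains a finitely
  generated ideal `G` with `G⁻¹ = R`, and `G` is a GV-ideal; hence `t`-invertibility is the same as
  `w`-invertibility.
* A module whose identity has finite rank up to GV-ideals is `w`-flat (`isWFlat_of_id_mem`). The
  module `Tor₁(R/I, M)` is GV-torsion if and only if `I ⊗ M → M` is a `w`-monomorphism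
  (`isGVTorsion_tor_iff`), so `w`-flatness of the ideals `I` passes semi-regular `w`-flatness on
  to submodules.
* Conversely, each flatness condition implies that `I ⊗ I → I` is a `w`-monomorphism. Then
  `a ⊗ b = b ⊗ a` in the localizations of `I ⊗ I`, so that the fibres of `I` have dimension at most
  one and `I` is locally principal by Nakayama's lemma. For a dense ideal this produces the
  homomorphisms of finite rank (`IsDenseIdeal.id_mem_gvFiniteRank_of_isWMono`).
* If the global dimension is at most one, a comparison as in Schanuel's lemma of a resolution
  of `R / I` with `0 → I → R → R / I → 0` yields the same `w`-monomorphism. A resolution of length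
  zero has to be treated apart: it gives `I = I²` locally.
* Homomorphisms of finite rank act as zero on `Ext¹`, which gives `w`-projectivity. In the other
  direction the test module is the kernel of a free presentation of `(M / tor M)_w`, for which
  `Ext¹` contains the obstruction to a factorization of `j • id` through the free module
  (`IsWProjective.mkQ_mem`). The property passes to extensions (`mkQ_mem_of_extension`), and this
  covers the semi-regular modules.
-/

namespace WModule

variable {R : Type u} [CommRing R]

/-! ### Closures with respect to GV-ideals -/

section GVClosure

variable {E F : Type u} [AddCommGroup E] [Module R E] [AddCommGroup F] [Module R F]

theorem mem_gvClosure {N : Submodule R E} {x : E} :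
    x ∈ gvClosure R N ↔ ∃ J : Ideal R, IsGV R J ∧ ∀ j ∈ J, j • x ∈ N := Iff.rfl

theorem le_gvClosure (N : Submodule R E) : N ≤ gvClosure R N :=
  fun _ hx => ⟨⊤, isGV_top, fun j _ => N.smul_mem j hx⟩

theorem gvClosure_mono {N N' : Submodule R E} (h : N ≤ N') : gvClosure R N ≤ gvClosure R N' :=
  fun _ ⟨J, hJ, hx⟩ => ⟨J, hJ, fun j hj => h (hx j hj)⟩

theorem apply_mem_gvClosure_iff (f : E →ₗ[R] F) (N : Submodule R F) {x : E} :
    f x ∈ gvClosure R N ↔ x ∈ gvClosure R (N.comap f) := by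
  simp [mem_gvClosure]

theorem mkQ_mem_gvTor_iff {N : Submodule R E} {x : E} :
    N.mkQ x ∈ gvTor R (E ⧸ N) ↔ x ∈ gvClosure R N := by
  rw [gvTor, apply_mem_gvClosure_iff, Submodule.comap_bot, Submodule.ker_mkQ]

/-- A finitely generated submodule of a closure is carried into the submodule by a single
GV-ideal: this is where GV-ideals being stable under products is used. -/
theorem exists_isGV_smul_le {N N' : Submodule R E} (hfg : N'.FG) (h : N' ≤ gvClosure R N) :
    ∃ J : Ideal R, IsGV R J ∧ J • N' ≤ N := by
  induction N', hfg using Submodule.fg_induction with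
  | singleton x =>
    obtain ⟨J, hJ, h⟩ := h (Submodule.mem_span_singleton_self x)
    refine ⟨J, hJ, Submodule.smul_le.2 fun j hj y hy => ?_⟩
    obtain ⟨c, rfl⟩ := Submodule.mem_span_singleton.1 hy
    rw [smul_comm]
    exact N.smul_mem c (h j hj)
  | sup N₁ N₂ _ _ h₁ h₂ =>
    obtain ⟨J₁, hJ₁, h₁⟩ := h₁ (le_sup_left.trans h)
    obtain ⟨J₂, hJ₂, h₂⟩ := h₂ (le_sup_right.trans h)
    refine ⟨J₁ * J₂, hJ₁.mul hJ₂, ?_⟩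
    rw [Submodule.smul_sup]
    exact sup_le ((Submodule.smul_mono_left Ideal.mul_le_left).trans h₁)
      ((Submodule.smul_mono_left Ideal.mul_le_right).trans h₂)

theorem mem_gvClosure_of_forall_smul_mem {N : Submodule R E} {x : E} {J : Ideal R}
    (hJ : IsGV R J) (h : ∀ j ∈ J, j • x ∈ gvClosure R N) : x ∈ gvClosure R N := by
  have hle : Submodule.map (LinearMap.toSpanSingleton R E x) J ≤ gvClosure R N := by
    rintro _ ⟨j, hj, rfl⟩
    exact h j hj
  obtain ⟨J', hJ', h'⟩ := exists_isGV_smul_le (Submodule.FG.map _ hJ.1) hle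
  refine ⟨J' * J, hJ'.mul hJ, fun j hj => ?_⟩
  induction hj using Submodule.mul_induction_on' with
  | mem_mul_mem a ha b hb =>
    rw [mul_smul]
    exact h' (Submodule.smul_mem_smul ha ⟨b, hb, rfl⟩)
  | add a _ b _ h₁ h₂ =>
    rw [add_smul]
    exact add_mem h₁ h₂

theorem gvClosure_idem (N : Submodule R E) : gvClosure R (gvClosure R N) = gvClosure R N :=
  le_antisymm (fun _ ⟨_, hJ, h⟩ => mem_gvClosure_of_forall_smul_mem hJ h) (le_gvClosure _)

theorem apply_mem_gvClosure_map (f : E →ₗ[R] F) {N : Submodule R E} {x : E}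
    (h : x ∈ gvClosure R N) : f x ∈ gvClosure R (N.map f) :=
  (apply_mem_gvClosure_iff f _).2 (gvClosure_mono (Submodule.le_comap_map f N) h)

theorem apply_mem_gvTor (f : E →ₗ[R] F) {x : E} (h : x ∈ gvTor R E) : f x ∈ gvTor R F := by
  have := apply_mem_gvClosure_map f h
  rwa [Submodule.map_bot] at this

theorem isGVTorsionFree_iff : IsGVTorsionFree R E ↔ ∀ x ∈ gvTor R E, x = 0 := by
  rw [IsGVTorsionFree, Submodule.eq_bot_iff]

theorem IsGVTorsionFree.of_injective (hF : IsGVTorsionFree R F) (f : E →ₗ[R] F)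
    (hf : Function.Injective f) : IsGVTorsionFree R E :=
  isGVTorsionFree_iff.2 fun x hx => hf (by
    rw [map_zero]
    exact isGVTorsionFree_iff.1 hF _ (apply_mem_gvTor f hx))

theorem isGVTorsionFree_quotient_gvClosure (N : Submodule R E) :
    IsGVTorsionFree R (E ⧸ gvClosure R N) := by
  refine isGVTorsionFree_iff.2 fun x hx => ?_
  obtain ⟨x, rfl⟩ := Submodule.mkQ_surjective _ x
  rw [mkQ_mem_gvTor_iff, gvClosure_idem] at hx
  simpa using hx

variable (R) in
theorem isGVTorsionFree_self : IsGVTorsionFree R R := by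
  refine isGVTorsionFree_iff.2 fun r ⟨J, hJ, h⟩ => ?_
  exact (isGV_iff.1 hJ).2.1 r h

theorem isGVTorsionFree_finsupp (ι : Type u) : IsGVTorsionFree R (ι →₀ R) := by
  refine isGVTorsionFree_iff.2 fun x hx => ?_
  ext i
  exact isGVTorsionFree_iff.1 (isGVTorsionFree_self R) _ (apply_mem_gvTor (Finsupp.lapply i) hx)

theorem IsGVTorsionFree.eq_of_forall_smul (hE : IsGVTorsionFree R E) {J : Ideal R}
    (hJ : IsGV R J) {x y : E} (h : ∀ j ∈ J, j • x = j • y) : x = y :=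
  sub_eq_zero.1 (isGVTorsionFree_iff.1 hE _ ⟨J, hJ, fun j hj => by
    rw [Submodule.mem_bot, smul_sub, h j hj, sub_self]⟩)

/-- A linear map with GV-torsion kernel and GV-torsion cokernel. These are the
`w`-isomorphisms, described without localization; see `isWIso_iff`. -/
structure IsGVIso (k : E →ₗ[R] F) : Prop where
  ker_le : LinearMap.ker k ≤ gvTor R E
  mem_closure : ∀ y, y ∈ gvClosure R (LinearMap.range k)

/-- Homomorphisms into `R` extend along `w`-isomorphisms, because `Hom(J, R) = R` for every
GV-ideal `J`. -/
theorem IsGVIso.exists_extend {k : E →ₗ[R] F} (hk : IsGVIso k) (h : E →ₗ[R] R) :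
    ∃ h' : F →ₗ[R] R, ∀ x, h' (k x) = h x := by
  have tf := isGVTorsionFree_iff.1 (isGVTorsionFree_self R)
  have hker : ∀ a b, k a = k b → h a = h b := by
    intro a b hab
    refine sub_eq_zero.1 ?_
    rw [← map_sub]
    refine tf _ (apply_mem_gvTor h (hk.ker_le ?_))
    rw [LinearMap.mem_ker, map_sub, hab, sub_self]
  -- the value at `y` is the unique `r` with `j r = h x` whenever `k x = j y` and `j ∈ J`
  have key : ∀ y, ∃ r : R, ∀ (j : R) (x : E), k x = j • y → h x = j * r := by
    intro y
    obtain ⟨J, hJ, hy⟩ := hk.mem_closure y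
    choose g hg using fun j : J => hy j j.2
    let φ : J →ₗ[R] R :=
      { toFun := fun j => h (g j)
        map_add' := fun a b => by
          rw [← map_add]
          exact hker _ _ (by rw [hg, map_add, hg, hg, Submodule.coe_add, add_smul])
        map_smul' := fun c a => by
          rw [RingHom.id_apply, ← map_smul]
          exact hker _ _ (by rw [hg, map_smul, hg, Submodule.coe_smul, smul_eq_mul, mul_smul]) }
    obtain ⟨r, hr⟩ := (isGV_iff.1 hJ).2.2 φ
    refine ⟨r, fun j x hx => (isGVTorsionFree_self R).eq_of_forall_smul hJ fun i hi => ?_⟩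
    have h1 : h (g ⟨i, hi⟩) = r * i := hr ⟨i, hi⟩
    have h2 : h (i • x) = h (j • g ⟨i, hi⟩) :=
      hker _ _ (by rw [map_smul, map_smul, hx, hg, smul_comm])
    rw [map_smul, map_smul, h1] at h2
    rw [h2]
    simp only [smul_eq_mul]
    ring
  choose v hv using key
  -- to identify a value it is enough to test it against a GV-ideal
  have test : ∀ y (r : R) (J : Ideal R), IsGV R J →
      (∀ j ∈ J, ∃ x, k x = j • y ∧ h x = j * r) → v y = r := by
    intro y r J hJ hr
    refine (isGVTorsionFree_self R).eq_of_forall_smul hJ fun j hj => ?_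
    obtain ⟨x, hx, hx'⟩ := hr j hj
    exact (hv y j x hx).symm.trans hx'
  refine ⟨{ toFun := v, map_add' := fun y z => ?_, map_smul' := fun c y => ?_ }, fun x => ?_⟩
  · obtain ⟨J₁, hJ₁, h₁⟩ := hk.mem_closure y
    obtain ⟨J₂, hJ₂, h₂⟩ := hk.mem_closure z
    refine test _ _ _ (hJ₁.mul hJ₂) fun j hj => ?_
    obtain ⟨a, ha⟩ := h₁ j (Ideal.mul_le_left hj)
    obtain ⟨b, hb⟩ := h₂ j (Ideal.mul_le_right hj)
    exact ⟨a + b, by rw [map_add, ha, hb, smul_add],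
      by rw [map_add, hv y j a ha, hv z j b hb, mul_add]⟩
  · obtain ⟨J, hJ, h₁⟩ := hk.mem_closure y
    refine test _ _ _ hJ fun j hj => ?_
    obtain ⟨a, ha⟩ := h₁ j hj
    refine ⟨c • a, by rw [map_smul, ha, smul_comm], ?_⟩
    rw [map_smul, hv y j a ha, RingHom.id_apply, smul_eq_mul, smul_eq_mul, mul_left_comm]
  · exact test _ _ _ isGV_top fun j _ => ⟨j • x, map_smul _ _ _, by rw [map_smul, smul_eq_mul]⟩

end GVClosure

section FiniteRank

variable {E F G H : Type u} [AddCommGroup E] [Module R E] [AddCommGroup F] [Module R F]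
  [AddCommGroup G] [Module R G] [AddCommGroup H] [Module R H]

variable (R E F) in
/-- The homomorphisms `E → F` that factor through a finitely generated free module. -/
def finiteRank : Submodule R (E →ₗ[R] F) :=
  Submodule.span R {φ | ∃ (h : E →ₗ[R] R) (y : F), φ = h.smulRight y}

variable (R E F) in
/-- The homomorphisms `φ : E → F` such that `j φ` factors through a finitely generated free module
for all `j` in a suitable GV-ideal. -/
def gvFiniteRank : Submodule R (E →ₗ[R] F) := gvClosure R (finiteRank R E F)

theorem smulRight_mem_finiteRank (h : E →ₗ[R] R) (y : F) : h.smulRight y ∈ finiteRank R E F :=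
  Submodule.subset_span ⟨h, y, rfl⟩

theorem finiteRank_comp {φ : E →ₗ[R] F} (hφ : φ ∈ finiteRank R E F) (g : F →ₗ[R] G)
    (f : H →ₗ[R] E) : g ∘ₗ φ ∘ₗ f ∈ finiteRank R H G := by
  induction hφ using Submodule.span_induction with
  | mem φ h =>
    obtain ⟨h, y, rfl⟩ := h
    have : g ∘ₗ h.smulRight y ∘ₗ f = (h ∘ₗ f).smulRight (g y) := by ext; simp
    rw [this]
    exact smulRight_mem_finiteRank _ _
  | zero => simp
  | add φ ψ _ _ h₁ h₂ =>
    rw [LinearMap.add_comp, LinearMap.comp_add]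
    exact add_mem h₁ h₂
  | smul c φ _ h =>
    rw [LinearMap.smul_comp, LinearMap.comp_smul]
    exact Submodule.smul_mem _ c h

theorem gvFiniteRank_comp {φ : E →ₗ[R] F} (hφ : φ ∈ gvFiniteRank R E F) (g : F →ₗ[R] G)
    (f : H →ₗ[R] E) : g ∘ₗ φ ∘ₗ f ∈ gvFiniteRank R H G := by
  obtain ⟨J, hJ, h⟩ := hφ
  refine ⟨J, hJ, fun j hj => ?_⟩
  have := finiteRank_comp (h j hj) g f
  rwa [LinearMap.smul_comp, LinearMap.comp_smul] at this

/-- Being of finite rank up to GV-torsion may be tested after restriction along a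
`w`-isomorphism of the source, if the target is GV-torsion-free. -/
theorem mem_gvFiniteRank_of_comp {k : E →ₗ[R] F} (hk : IsGVIso k) (hG : IsGVTorsionFree R G)
    {φ : F →ₗ[R] G} (hφ : φ ∘ₗ k ∈ gvFiniteRank R E G) : φ ∈ gvFiniteRank R F G := by
  obtain ⟨J, hJ, h⟩ := hφ
  refine ⟨J, hJ, fun j hj => ?_⟩
  have ext : ∀ ψ ∈ finiteRank R E G, ∃ ψ' ∈ finiteRank R F G, ψ' ∘ₗ k = ψ := by
    intro ψ hψ
    induction hψ using Submodule.span_induction with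
    | mem ψ hψ =>
      obtain ⟨h, y, rfl⟩ := hψ
      obtain ⟨h', hh'⟩ := hk.exists_extend h
      exact ⟨h'.smulRight y, smulRight_mem_finiteRank _ _, by ext; simp [hh']⟩
    | zero => exact ⟨0, zero_mem _, by simp⟩
    | add ψ₁ ψ₂ _ _ h₁ h₂ =>
      obtain ⟨ψ₁', h₁, rfl⟩ := h₁
      obtain ⟨ψ₂', h₂, rfl⟩ := h₂
      exact ⟨_, add_mem h₁ h₂, LinearMap.add_comp _ _ _⟩
    | smul c ψ _ h =>
      obtain ⟨ψ', h, rfl⟩ := h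
      exact ⟨_, Submodule.smul_mem _ c h, LinearMap.smul_comp _ _ _⟩
  obtain ⟨ψ, hψ, hψk⟩ := ext _ (h j hj)
  have : j • φ = ψ := by
    ext y
    obtain ⟨J', hJ', hy⟩ := hk.mem_closure y
    refine hG.eq_of_forall_smul hJ' fun i hi => ?_
    obtain ⟨x, hx⟩ := hy i hi
    rw [← map_smul, ← map_smul, ← hx]
    exact (LinearMap.congr_fun hψk x).symm
  rwa [this]

/-- Being of finite rank up to GV-torsion may be tested after an injective `w`-isomorphism of the
target. -/
theorem mem_gvFiniteRank_of_comp_left {k : F →ₗ[R] G} (hk : IsGVIso k)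
    (hk' : Function.Injective k) {φ : E →ₗ[R] F} (hφ : k ∘ₗ φ ∈ gvFiniteRank R E G) :
    φ ∈ gvFiniteRank R E F := by
  obtain ⟨J, hJ, h⟩ := hφ
  refine mem_gvClosure_of_forall_smul_mem hJ fun j hj => ?_
  have lift : ∀ ψ ∈ finiteRank R E G, ψ ∈ gvClosure R ((finiteRank R E F).map
      (LinearMap.compRight R (M := E) k)) := by
    intro ψ hψ
    induction hψ using Submodule.span_induction with
    | mem ψ hψ =>
      obtain ⟨h, y, rfl⟩ := hψ
      obtain ⟨J', hJ', hy⟩ := hk.mem_closure y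
      refine ⟨J', hJ', fun i hi => ?_⟩
      obtain ⟨x, hx⟩ := hy i hi
      refine ⟨h.smulRight x, smulRight_mem_finiteRank _ _, ?_⟩
      ext e
      change k (h e • x) = i • (h e • y)
      rw [map_smul, hx, smul_comm]
    | zero => exact zero_mem _
    | add ψ₁ ψ₂ _ _ h₁ h₂ => exact add_mem h₁ h₂
    | smul c ψ _ h => exact Submodule.smul_mem _ c h
  obtain ⟨J', hJ', h'⟩ := lift _ (h j hj)
  refine ⟨J', hJ', fun i hi => ?_⟩
  obtain ⟨ψ, hψ, hψk⟩ := h' i hi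
  have : i • j • φ = ψ := by
    ext x
    apply hk'
    have := LinearMap.congr_fun hψk x
    simpa using this.symm
  rwa [this]

end FiniteRank

/-! ### Ext and maximal `w`-ideals -/

section Ext

open Abelian

variable {E F L : Type u} [AddCommGroup E] [Module R E] [AddCommGroup F] [Module R F]
  [AddCommGroup L] [Module R L]

theorem subsingleton_ext_quotient_iff (J : Ideal R) :
    Subsingleton (Ext.{u} (ModuleCat.of R (R ⧸ J)) (ModuleCat.of R E) 1) ↔
      ∀ φ : J →ₗ[R] E, ∃ x : E, ∀ j : J, φ j = (j : R) • x := by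
  let S : ShortComplex (ModuleCat.{u} R) :=
    ModuleCat.shortComplexOfCompEqZero (M := J) (N := R) (L := R ⧸ J) J.subtype
      (Submodule.mkQ J) (by ext j; exact (Submodule.Quotient.mk_eq_zero J).2 j.2)
  have hS : S.ShortExact := ModuleCat.shortComplex_shortExact S
    (LinearMap.exact_subtype_mkQ J) Subtype.val_injective (Submodule.mkQ_surjective J)
  constructor
  · intro h φ
    obtain ⟨e, he⟩ := Ext.contravariant_sequence_exact₁ hS (ModuleCat.of R E)
      (Ext.mk₀ (ModuleCat.ofHom φ : S.X₁ ⟶ ModuleCat.of R E)) (n₁ := 1) rfl (h.elim _ _)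
    obtain ⟨ψ, rfl⟩ := (Ext.mk₀_bijective _ _).2 e
    rw [Ext.mk₀_comp_mk₀] at he
    have h2 := (Ext.mk₀_bijective _ _).1 he
    let ψ' : R →ₗ[R] E := ψ.hom
    refine ⟨ψ' 1, fun j => ?_⟩
    have h3 : ψ' j = φ j := congrArg (fun f => f.hom j) h2
    rw [← h3, ← map_smul, smul_eq_mul, mul_one]
  · intro h
    refine subsingleton_of_forall_eq 0 fun e => ?_
    have : Projective S.X₂ := inferInstanceAs (Projective (ModuleCat.of R R))
    obtain ⟨e₁, he₁⟩ := Ext.contravariant_sequence_exact₃ hS (ModuleCat.of R E) (n₁ := 1)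
      (n₀ := 0) e
      (Ext.eq_zero_of_projective _) rfl
    obtain ⟨φ, rfl⟩ := (Ext.mk₀_bijective _ _).2 e₁
    let φ' : J →ₗ[R] E := φ.hom
    obtain ⟨x, hx⟩ := h φ'
    have : φ = S.f ≫ (ModuleCat.ofHom (LinearMap.toSpanSingleton R E x) :
        S.X₂ ⟶ ModuleCat.of R E) := by
      ext j
      exact hx j
    rw [← he₁, this, ← Ext.mk₀_comp_mk₀, hS.extClass_comp_assoc]

theorem isWModule_iff : IsWModule R E ↔ IsGVTorsionFree R E ∧
    ∀ J : Ideal R, IsGV R J → ∀ φ : J →ₗ[R] E, ∃ x : E, ∀ j : J, φ j = (j : R) • x := by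
  simp only [IsWModule, subsingleton_ext_quotient_iff]

/-- If `j • id` factors through a finitely generated free module, then `j` annihilates `Ext¹`. -/
theorem isGVTorsion_ext_of_id_mem (h : LinearMap.id ∈ gvFiniteRank R L L) :
    IsGVTorsion R (Ext.{u} (ModuleCat.of R L) (ModuleCat.of R E) 1) := by
  obtain ⟨J, hJ, h⟩ := h
  refine eq_top_iff.2 fun e _ => ⟨J, hJ, fun j hj => ?_⟩
  have key : ∀ φ ∈ finiteRank R L L,
      (Ext.mk₀ (ModuleCat.ofHom φ)).comp e (zero_add 1) = 0 := by
    intro φ hφ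
    induction hφ using Submodule.span_induction with
    | mem φ hφ =>
      obtain ⟨f, y, rfl⟩ := hφ
      have : ModuleCat.ofHom (f.smulRight y) =
          ModuleCat.ofHom f ≫ ModuleCat.ofHom (LinearMap.toSpanSingleton R L y) := by
        ext; simp
      rw [this, ← Ext.mk₀_comp_mk₀_assoc,
        Ext.eq_zero_of_projective (P := ModuleCat.of R R) ((Ext.mk₀ _).comp e _), Ext.comp_zero]
    | zero =>
      rw [show ModuleCat.ofHom (0 : L →ₗ[R] L) = 0 from rfl, Ext.mk₀_zero, Ext.zero_comp]
    | add φ ψ _ _ h₁ h₂ =>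
      rw [ModuleCat.ofHom_add, Ext.mk₀_add, Ext.add_comp, h₁, h₂, add_zero]
    | smul c φ _ h =>
      rw [show ModuleCat.ofHom (c • φ) = c • ModuleCat.ofHom φ from rfl, Ext.mk₀_smul,
        Ext.smul_comp, h, smul_zero]
  have h1 := key _ (h j hj)
  rw [show ModuleCat.ofHom (j • (LinearMap.id : L →ₗ[R] L)) = j • 𝟙 (ModuleCat.of R L) from rfl,
    Ext.mk₀_smul, Ext.smul_comp, Ext.mk₀_id_comp] at h1
  exact h1

/-- The obstruction to lifting `j • id` along a surjection `F → L` with kernel `K` is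
`j` times the class of the extension in `Ext¹(L, K)`. -/
theorem exists_lift_of_isGVTorsion_ext (π : F →ₗ[R] L) (hπ : Function.Surjective π)
    (h : IsGVTorsion R (Ext.{u} (ModuleCat.of R L) (ModuleCat.of R (LinearMap.ker π)) 1)) :
    ∃ J : Ideal R, IsGV R J ∧ ∀ j ∈ J, ∃ s : L →ₗ[R] F, ∀ x, π (s x) = j • x := by
  let S : ShortComplex (ModuleCat.{u} R) := π.shortComplexKer
  have hS : S.ShortExact := LinearMap.shortExact_shortComplexKer hπ
  obtain ⟨J, hJ, h⟩ : hS.extClass ∈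
      gvTor R (Ext.{u} (ModuleCat.of R L) (ModuleCat.of R (LinearMap.ker π)) 1) := by
    rw [show gvTor R _ = ⊤ from h]
    trivial
  refine ⟨J, hJ, fun j hj => ?_⟩
  obtain ⟨e, he⟩ := Ext.covariant_sequence_exact₃ (ModuleCat.of R L) hS
    (Ext.mk₀ (j • 𝟙 (ModuleCat.of R L))) (n₁ := 1) rfl (by
      rw [Ext.mk₀_smul, Ext.smul_comp, Ext.mk₀_id_comp]
      exact h j hj)
  obtain ⟨s, rfl⟩ := (Ext.mk₀_bijective _ _).2 e
  rw [Ext.mk₀_comp_mk₀] at he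
  have h2 := (Ext.mk₀_bijective _ _).1 he
  exact ⟨s.hom, fun x => congrArg (fun f => f.hom x) h2⟩

end Ext

section MaximalWIdeals

theorem isWModule_ideal_iff {I : Ideal R} : IsWModule R I ↔ gvClosure R I = I := by
  rw [isWModule_iff]
  constructor
  · rintro ⟨-, h⟩
    refine le_antisymm (fun r ⟨J, hJ, hr⟩ => ?_) (le_gvClosure I)
    obtain ⟨x, hx⟩ := h J hJ ((LinearMap.toSpanSingleton R R r).restrict hr)
    have : r = x := (isGVTorsionFree_self R).eq_of_forall_smul hJ fun j hj =>
      congrArg Subtype.val (hx ⟨j, hj⟩)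
    rw [this]
    exact x.2
  · intro h
    refine ⟨(isGVTorsionFree_self R).of_injective (Submodule.subtype I) Subtype.val_injective,
      fun J hJ φ => ?_⟩
    obtain ⟨r, hr⟩ := (isGV_iff.1 hJ).2.2 ((Submodule.subtype I) ∘ₗ φ)
    have hrI : r ∈ I := by
      rw [← h]
      refine ⟨J, hJ, fun j hj => ?_⟩
      rw [smul_eq_mul, mul_comm, ← hr ⟨j, hj⟩]
      exact (φ ⟨j, hj⟩).2
    refine ⟨⟨r, hrI⟩, fun j => Subtype.ext ?_⟩
    exact (hr j).trans (mul_comm _ _)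

theorem isMaximalWIdeal_iff {m : Ideal R} :
    IsMaximalWIdeal R m ↔ Maximal (fun I : Ideal R => I ≠ ⊤ ∧ gvClosure R I = I) m := by
  simp only [IsMaximalWIdeal, isWModule_ideal_iff]

theorem IsMaximalWIdeal.not_le {m : Ideal R} (hm : IsMaximalWIdeal R m) {J : Ideal R}
    (hJ : IsGV R J) : ¬ J ≤ m := by
  intro h
  obtain ⟨⟨h1, h2⟩, -⟩ := isMaximalWIdeal_iff.1 hm
  refine h1 ((Ideal.eq_top_iff_one m).2 ?_)
  rw [← h2]
  exact ⟨J, hJ, fun j hj => by simpa using h hj⟩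

theorem IsMaximalWIdeal.isPrime {m : Ideal R} (hm : IsMaximalWIdeal R m) : m.IsPrime := by
  obtain ⟨⟨h1, h2⟩, h3⟩ := isMaximalWIdeal_iff.1 hm
  refine ⟨h1, fun {a b} hab => or_iff_not_imp_right.2 fun hb => ?_⟩
  -- the ideal `(m : a)` is closed
  let I : Ideal R := Submodule.comap (LinearMap.toSpanSingleton R R a) m
  have hI : ∀ r, r ∈ I ↔ r * a ∈ m := fun r => Iff.rfl
  by_contra ha
  refine hb ?_
  have hle : m ≤ I := fun r hr => m.mul_mem_right a hr
  have hcl : gvClosure R I = I := by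
    refine le_antisymm (fun r hr => ?_) (le_gvClosure I)
    have := (apply_mem_gvClosure_iff (LinearMap.toSpanSingleton R R a) m).2 hr
    rw [h2] at this
    exact this
  have hne : I ≠ ⊤ := fun h => ha (by simpa [hI] using (Ideal.eq_top_iff_one I).1 h)
  refine h3 ⟨hne, hcl⟩ hle ?_
  rw [hI, mul_comm]
  exact hab

theorem exists_isMaximalWIdeal_le {I : Ideal R} (hI : I ≠ ⊤) (hI' : gvClosure R I = I) :
    ∃ m, IsMaximalWIdeal R m ∧ I ≤ m := by
  obtain ⟨m, h1, h2⟩ := zorn_le_nonempty₀ {I : Ideal R | I ≠ ⊤ ∧ gvClosure R I = I} (by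
    intro c hc hchain I₀ hI₀
    have hdir := hchain.directedOn
    refine ⟨sSup c, ⟨?_, le_antisymm (fun r hr => ?_) (le_gvClosure _)⟩, fun _ => le_sSup⟩
    · rw [Ne, Ideal.eq_top_iff_one, Submodule.mem_sSup_of_directed ⟨I₀, hI₀⟩ hdir]
      rintro ⟨I₁, hI₁, h⟩
      exact (hc hI₁).1 ((Ideal.eq_top_iff_one I₁).2 h)
    · obtain ⟨J, hJ, hr⟩ := hr
      -- `J r` is finitely generated, so it lies in a member of the chain
      have hfg : (Submodule.map (LinearMap.toSpanSingleton R R r) J).FG :=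
        Submodule.FG.map _ hJ.1
      have hcpt := (Submodule.fg_iff_compact _).1 hfg
      obtain ⟨I₁, hI₁, h⟩ := (CompleteLattice.isCompactElement_iff_le_of_directed_sSup_le _ _).1
        hcpt c ⟨I₀, hI₀⟩ hdir (by
          rintro _ ⟨j, hj, rfl⟩
          exact hr j hj)
      have : r ∈ gvClosure R I₁ := ⟨J, hJ, fun j hj => h ⟨j, hj, rfl⟩⟩
      rw [(hc hI₁).2] at this
      exact Submodule.mem_sSup_of_mem hI₁ this) I ⟨hI, hI'⟩
  exact ⟨m, isMaximalWIdeal_iff.2 h2, h1⟩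

/-- The local-global principle: an element lies in the closure of a submodule if and only if it
does so after localization at every maximal `w`-ideal. -/
theorem mem_gvClosure_iff_forall_isMaximalWIdeal {E : Type u} [AddCommGroup E] [Module R E]
    {N : Submodule R E} {x : E} :
    x ∈ gvClosure R N ↔ ∀ m : Ideal R, IsMaximalWIdeal R m → ∃ s ∉ m, s • x ∈ N := by
  constructor
  · rintro ⟨J, hJ, hx⟩ m hm
    obtain ⟨s, hsJ, hs⟩ := Set.not_subset.1 (hm.not_le hJ)
    exact ⟨s, hs, hx s hsJ⟩
  · intro h
    by_contra hx
    -- the ideal `(N_w : x)` is closed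
    let I : Ideal R := Submodule.comap (LinearMap.toSpanSingleton R E x) (gvClosure R N)
    have hI : ∀ r, r ∈ I ↔ r • x ∈ gvClosure R N := fun r => Iff.rfl
    obtain ⟨m, hm, hIm⟩ := exists_isMaximalWIdeal_le (I := I)
      (fun h => hx (by simpa [hI] using (Ideal.eq_top_iff_one I).1 h)) (by
        refine le_antisymm (fun r hr => ?_) (le_gvClosure I)
        have := (apply_mem_gvClosure_iff (LinearMap.toSpanSingleton R E x) _).2 hr
        rw [gvClosure_idem] at this
        exact this)
    obtain ⟨s, hs, hsx⟩ := h m hm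
    exact hs (hIm (le_gvClosure N hsx))

end MaximalWIdeals

section WMaps

variable {A B C : Type u} [AddCommGroup A] [Module R A] [AddCommGroup B] [Module R B]
  [AddCommGroup C] [Module R C]

theorem locMap_mk (m : Ideal R) [m.IsPrime] (f : A →ₗ[R] B) (a : A) (s : m.primeCompl) :
    locMap m f (LocalizedModule.mk a s) = LocalizedModule.mk (f a) s := by
  rw [IsLocalizedModule.mk_eq_mk', IsLocalizedModule.mk_eq_mk']
  exact IsLocalizedModule.map_mk' _ _ _ _ _ _

theorem mk_eq_zero_iff {m : Ideal R} [m.IsPrime] {a : A} {s : m.primeCompl} :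
    (LocalizedModule.mk a s : LocalizedModule m.primeCompl A) = 0 ↔ ∃ t ∉ m, t • a = 0 := by
  rw [← LocalizedModule.zero_mk s, LocalizedModule.mk_eq]
  constructor
  · rintro ⟨u, hu⟩
    rw [smul_zero, smul_zero, ← mul_smul] at hu
    exact ⟨(u * s : m.primeCompl), (u * s).2, hu⟩
  · rintro ⟨t, ht, hta⟩
    refine ⟨⟨t, ht⟩, ?_⟩
    rw [smul_zero, smul_zero, smul_comm]
    exact (congrArg _ hta).trans (smul_zero _)

theorem locMap_injective_iff {m : Ideal R} [m.IsPrime] {f : A →ₗ[R] B} :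
    Function.Injective (locMap m f) ↔ ∀ a, f a = 0 → ∃ s ∉ m, s • a = 0 := by
  rw [injective_iff_map_eq_zero]
  constructor
  · intro h a ha
    refine mk_eq_zero_iff.1 (h (LocalizedModule.mk a 1) ?_)
    rw [locMap_mk, ha, LocalizedModule.zero_mk]
  · intro h x
    induction x using LocalizedModule.induction_on with
    | h a s =>
      rw [locMap_mk, mk_eq_zero_iff, mk_eq_zero_iff]
      rintro ⟨t, ht, hta⟩
      rw [← map_smul] at hta
      obtain ⟨s', hs', h'⟩ := h _ hta
      exact ⟨s' * t, (Ideal.IsPrime.mul_notMem inferInstance hs' ht), by rwa [mul_smul]⟩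

theorem locMap_surjective_iff {m : Ideal R} [m.IsPrime] {f : A →ₗ[R] B} :
    Function.Surjective (locMap m f) ↔ ∀ b, ∃ s ∉ m, s • b ∈ LinearMap.range f := by
  constructor
  · intro h b
    obtain ⟨x, hx⟩ := h (LocalizedModule.mk b 1)
    induction x using LocalizedModule.induction_on with
    | h a s =>
      rw [locMap_mk, LocalizedModule.mk_eq] at hx
      obtain ⟨u, hu⟩ := hx
      rw [one_smul] at hu
      refine ⟨(u * s : m.primeCompl), (u * s).2, ⟨(u : R) • a, ?_⟩⟩
      rw [map_smul, Submonoid.coe_mul, mul_smul]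
      exact hu
  · intro h x
    induction x using LocalizedModule.induction_on with
    | h b s =>
      obtain ⟨t, ht, a, ha⟩ := h b
      refine ⟨LocalizedModule.mk a (⟨t, ht⟩ * s), ?_⟩
      rw [locMap_mk, ha]
      exact LocalizedModule.mk_cancel_common_left ⟨t, ht⟩ s b

theorem isWMono_iff {f : A →ₗ[R] B} : IsWMono f ↔ LinearMap.ker f ≤ gvTor R A := by
  constructor
  · intro h a ha
    refine mem_gvClosure_iff_forall_isMaximalWIdeal.2 fun m hm => ?_
    have := hm.isPrime
    exact locMap_injective_iff.1 (h m hm) a ha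
  · intro h m _ hm
    exact locMap_injective_iff.2 fun a ha =>
      mem_gvClosure_iff_forall_isMaximalWIdeal.1 (h ha) m hm

theorem isWEpi_iff {f : A →ₗ[R] B} :
    IsWEpi f ↔ ∀ b, b ∈ gvClosure R (LinearMap.range f) := by
  constructor
  · intro h b
    refine mem_gvClosure_iff_forall_isMaximalWIdeal.2 fun m hm => ?_
    have := hm.isPrime
    exact locMap_surjective_iff.1 (h m hm) b
  · intro h m _ hm
    exact locMap_surjective_iff.2 fun b => mem_gvClosure_iff_forall_isMaximalWIdeal.1 (h b) m hm

theorem isWIso_iff {f : A →ₗ[R] B} : IsWIso f ↔ IsGVIso f := by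
  have : IsWIso f ↔ IsWMono f ∧ IsWEpi f :=
    ⟨fun h => ⟨fun m _ hm => (h m hm).1, fun m _ hm => (h m hm).2⟩,
      fun h m _ hm => ⟨h.1 m hm, h.2 m hm⟩⟩
  rw [this, isWMono_iff, isWEpi_iff]
  exact ⟨fun h => ⟨h.1, h.2⟩, fun h => ⟨h.1, h.2⟩⟩

theorem isWExact_of_exact {f : A →ₗ[R] B} {g : B →ₗ[R] C} (h : Function.Exact f g) :
    IsWExact f g :=
  fun m _ _ => IsLocalizedModule.map_exact m.primeCompl _ _ _ f g h

end WMaps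

/-! ### Finite fractions and invertibility -/

section FiniteFractions

open Polynomial

theorem IsDenseIdeal.mono {I J : Ideal R} (hI : IsDenseIdeal R I) (h : I ≤ J) :
    IsDenseIdeal R J := fun r hr => hI r fun x hx => hr x (h hx)

theorem IsSemiregularIdeal.isDenseIdeal {I : Ideal R} (hI : IsSemiregularIdeal R I) :
    IsDenseIdeal R I := by
  obtain ⟨D, -, hD, hDI⟩ := hI
  exact hD.mono hDI

theorem algebraMap_fractionRing_polynomial_injective :
    Function.Injective (algebraMap R (FractionRing R[X])) := by
  rw [IsScalarTower.algebraMap_eq R R[X] (FractionRing R[X])]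
  exact (IsFractionRing.injective R[X] (FractionRing R[X])).comp C_injective

theorem algebraMap_Q0_injective : Function.Injective (algebraMap R (Q0 R)) := fun _ _ h =>
  algebraMap_fractionRing_polynomial_injective (congrArg Subtype.val h)

theorem smul_mk'_fractionRing (r : R) (p : R[X]) (q : nonZeroDivisors R[X]) :
    r • IsLocalization.mk' (FractionRing R[X]) p q =
      IsLocalization.mk' (FractionRing R[X]) (r • p) q := by
  rw [Algebra.smul_def, IsScalarTower.algebraMap_apply R R[X] (FractionRing R[X]),
    IsLocalization.mul_mk'_eq_mk'_of_mul, Algebra.smul_def]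

theorem IsDenseIdeal.eq_zero_of_forall_smul {I : Ideal R} (hI : IsDenseIdeal R I) {x : Q0 R}
    (h : ∀ a ∈ I, a • x = 0) : x = 0 := by
  obtain ⟨x, hx⟩ := x
  refine Subtype.ext ?_
  change x = 0
  obtain ⟨p, q, rfl⟩ := IsLocalization.exists_mk'_eq (nonZeroDivisors R[X]) x
  have hp : p = 0 := by
    ext n
    refine hI _ fun a ha => ?_
    have h1 : a • IsLocalization.mk' (FractionRing R[X]) p q = 0 := congrArg Subtype.val (h a ha)
    rw [smul_mk'_fractionRing, IsLocalization.mk'_eq_zero_iff] at h1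
    obtain ⟨t, ht⟩ := h1
    have h2 : a • p = 0 := t.2.1 _ ht
    have h3 := congrArg (fun f => f.coeff n) h2
    simpa using h3
  rw [hp, IsLocalization.mk'_zero]

theorem IsDenseIdeal.eq_of_forall_smul {I : Ideal R} (hI : IsDenseIdeal R I) {x y : Q0 R}
    (h : ∀ a ∈ I, a • x = a • y) : x = y :=
  sub_eq_zero.1 (hI.eq_zero_of_forall_smul fun a ha => by rw [smul_sub, h a ha, sub_self])

/-- Every homomorphism `φ : I → R` on a finitely generated dense ideal is multiplication by a
finite fraction: if `b₀, …, bₙ` generate `I`, then `∑ bᵢ Xⁱ` is regular by McCoy's theorem, and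
`φ` is multiplication by `(∑ φ(bᵢ) Xⁱ) / (∑ bᵢ Xⁱ)`. -/
theorem IsDenseIdeal.exists_smul_eq {I : Ideal R} (hI : IsDenseIdeal R I) (hfg : I.FG)
    (φ : I →ₗ[R] R) : ∃ x : Q0 R, ∀ b : I, (b : R) • x = algebraMap R (Q0 R) (φ b) := by
  obtain ⟨n, b, hb⟩ := Submodule.fg_iff_exists_fin_generating_family.1 hfg
  have hbI : ∀ i, b i ∈ I := fun i => by
    rw [← hb]
    exact Submodule.subset_span ⟨i, rfl⟩
  let f : R[X] := ∑ i : Fin n, monomial (i : ℕ) (b i)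
  let g : R[X] := ∑ i : Fin n, monomial (i : ℕ) (φ ⟨b i, hbI i⟩)
  have hf : f ∈ nonZeroDivisors R[X] := by
    refine Polynomial.mem_nonZeroDivisors_iff.2 fun a ha => hI a fun x hx => ?_
    have hz : ∀ i, b i * a = 0 := by
      intro i
      have h1 := congrArg (fun p => p.coeff (i : ℕ)) ha
      simp only [f, Finset.smul_sum, finsetSum_coeff, coeff_smul, coeff_monomial,
        Fin.val_inj, coeff_zero, smul_eq_mul] at h1
      rw [Finset.sum_eq_single i (fun j _ hj => by simp [hj]) (by simp)] at h1
      simpa [mul_comm] using h1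
    have hle : I ≤ LinearMap.ker (LinearMap.toSpanSingleton R R a) := by
      rw [← hb, Submodule.span_le]
      rintro _ ⟨i, rfl⟩
      exact hz i
    exact hle hx
  have key : ∀ a : I, (a : R) • IsLocalization.mk' (FractionRing R[X]) g ⟨f, hf⟩ =
      algebraMap R (FractionRing R[X]) (φ a) := by
    intro a
    rw [smul_mk'_fractionRing, IsLocalization.mk'_eq_iff_eq_mul,
      IsScalarTower.algebraMap_apply R R[X] (FractionRing R[X]), ← map_mul]
    congr 1
    change (a : R) • g = C (φ a) * f
    rw [← Polynomial.smul_eq_C_mul]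
    simp only [f, g, Finset.smul_sum, smul_monomial]
    refine Finset.sum_congr rfl fun i _ => ?_
    congr 1
    rw [← map_smul, smul_eq_mul, mul_comm, ← smul_eq_mul (b i), ← map_smul]
    congr 1
    ext
    exact mul_comm _ _
  exact ⟨⟨_, I, hfg, ⟨I, hfg, hI, le_rfl⟩, fun a ha => ⟨φ ⟨a, ha⟩, key ⟨a, ha⟩⟩⟩,
    fun b => Subtype.ext (key b)⟩

theorem mem_q0Inv {A : Submodule R (Q0 R)} {x : Q0 R} :
    x ∈ q0Inv A ↔ ∀ y ∈ A, ∃ r : R, x * y = algebraMap R (Q0 R) r := Iff.rfl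

theorem mem_q0Inv_toQ0 {I : Ideal R} {x : Q0 R} :
    x ∈ q0Inv (toQ0 I) ↔ ∀ a ∈ I, ∃ r : R, a • x = algebraMap R (Q0 R) r := by
  constructor
  · intro h a ha
    obtain ⟨r, hr⟩ := h _ (Submodule.mem_map_of_mem ha)
    exact ⟨r, by rw [← hr, Algebra.smul_def, mul_comm]; rfl⟩
  · rintro h _ ⟨a, ha, rfl⟩
    obtain ⟨r, hr⟩ := h a ha
    exact ⟨r, by rw [← hr, Algebra.smul_def, mul_comm]; rfl⟩

theorem exists_linearMap_of_mem_q0Inv {I : Ideal R} {x : Q0 R} (hx : x ∈ q0Inv (toQ0 I)) :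
    ∃ φ : I →ₗ[R] R, ∀ a : I, (a : R) • x = algebraMap R (Q0 R) (φ a) := by
  choose g hg using fun a : I => mem_q0Inv_toQ0.1 hx a a.2
  exact ⟨{ toFun := g
           map_add' := fun a b => algebraMap_Q0_injective (by
             rw [map_add, ← hg, ← hg, ← hg, Submodule.coe_add, add_smul])
           map_smul' := fun c a => algebraMap_Q0_injective (by
             rw [smul_eq_mul, map_mul, ← hg, ← hg, Submodule.coe_smul, smul_eq_mul, mul_smul,
               Algebra.smul_def c]
             rfl) }, hg⟩

theorem IsGV.mem_range_of_mem_q0Inv {J : Ideal R} (hJ : IsGV R J) {x : Q0 R}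
    (hx : x ∈ q0Inv (toQ0 J)) : x ∈ Set.range (algebraMap R (Q0 R)) := by
  obtain ⟨φ, hφ⟩ := exists_linearMap_of_mem_q0Inv hx
  obtain ⟨-, hd, h⟩ := isGV_iff.1 hJ
  obtain ⟨r, hr⟩ := h φ
  refine ⟨r, hd.eq_of_forall_smul fun a ha => ?_⟩
  rw [hφ ⟨a, ha⟩, hr, mul_comm, map_mul, Algebra.smul_def]

theorem coe_one_submodule_Q0 :
    ((1 : Submodule R (Q0 R)) : Set (Q0 R)) = Set.range (algebraMap R (Q0 R)) := by
  ext x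
  exact Submodule.mem_one

theorem mul_q0Inv_le_one (A : Submodule R (Q0 R)) : A * q0Inv A ≤ 1 := by
  refine Submodule.mul_le.2 fun a ha x hx => ?_
  obtain ⟨r, hr⟩ := hx a ha
  exact Submodule.mem_one.2 ⟨r, by rw [mul_comm, hr]⟩

theorem gvClosure_le_one {A : Submodule R (Q0 R)} (h : A ≤ 1) : gvClosure R A ≤ 1 := by
  rintro x ⟨J, hJ, hx⟩
  refine Submodule.mem_one.2 (hJ.mem_range_of_mem_q0Inv (mem_q0Inv_toQ0.2 fun a ha => ?_))
  obtain ⟨r, hr⟩ := Submodule.mem_one.1 (h (hx a ha))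
  exact ⟨r, hr.symm⟩

theorem isWInvertible_iff {I : Ideal R} :
    IsWInvertible I ↔ (1 : Q0 R) ∈ gvClosure R (toQ0 I * q0Inv (toQ0 I)) := by
  rw [IsWInvertible, ← coe_one_submodule_Q0, SetLike.coe_set_eq]
  constructor
  · intro h
    rw [h]
    exact Submodule.mem_one.2 ⟨1, map_one _⟩
  · intro h
    refine le_antisymm (gvClosure_le_one (mul_q0Inv_le_one _)) fun x hx => ?_
    obtain ⟨r, rfl⟩ := Submodule.mem_one.1 hx
    rw [Algebra.algebraMap_eq_smul_one]
    exact Submodule.smul_mem _ r h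

theorem le_q0Inv_q0Inv (A : Submodule R (Q0 R)) : A ≤ q0Inv (q0Inv A) := by
  intro a ha x hx
  obtain ⟨r, hr⟩ := hx a ha
  exact ⟨r, by rw [mul_comm, hr]⟩

theorem IsWInvertible.isTInvertible {I : Ideal R} (hI : IsWInvertible I) : IsTInvertible I := by
  obtain ⟨G, hG, h⟩ := isWInvertible_iff.1 hI
  have hA : toQ0 I * q0Inv (toQ0 I) ≤ 1 := mul_q0Inv_le_one (toQ0 I)
  refine ⟨q0Inv (toQ0 I), Set.Subset.antisymm ?_ ?_⟩
  · rintro x ⟨B, -, hB, -, hx⟩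
    have hB1 : B ≤ 1 := hB.trans hA
    have h1 : (1 : Q0 R) ∈ q0Inv B := by
      refine mem_q0Inv.2 fun y hy => ?_
      obtain ⟨r, hr⟩ := Submodule.mem_one.1 (hB1 hy)
      exact ⟨r, by rw [one_mul, hr]⟩
    obtain ⟨r, hr⟩ := mem_q0Inv.1 hx 1 h1
    exact ⟨r, by rw [← hr, mul_one]⟩
  · rintro _ ⟨r, rfl⟩
    refine ⟨toQ0 G, Submodule.FG.map _ hG.1, ?_, ⟨G, ⟨G, hG.1, (isGV_iff.1 hG).2.1, le_rfl⟩,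
      le_rfl⟩, fun y hy => ?_⟩
    · rintro _ ⟨g, hg, rfl⟩
      rw [Algebra.linearMap_apply, Algebra.algebraMap_eq_smul_one]
      exact h g hg
    · obtain ⟨s, rfl⟩ := hG.mem_range_of_mem_q0Inv hy
      exact ⟨r * s, (map_mul _ _ _).symm⟩

theorem IsTInvertible.isWInvertible {I : Ideal R} (hI : IsTInvertible I) : IsWInvertible I := by
  obtain ⟨J, hJ⟩ := hI
  obtain ⟨B, hBfg, hBA, ⟨D, hD, hDB⟩, h1⟩ : (1 : Q0 R) ∈ tClosure (toQ0 I * J) := by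
    rw [hJ]
    exact ⟨1, map_one _⟩
  have hA : toQ0 I * J ≤ 1 := by
    intro a ha
    have h2 : a ∈ tClosure (toQ0 I * J) := by
      refine ⟨B ⊔ Submodule.span R {a}, hBfg.sup (Submodule.fg_span_singleton a), ?_,
        ⟨D, hD, hDB.trans le_sup_left⟩, le_q0Inv_q0Inv _ ?_⟩
      · exact sup_le hBA ((Submodule.span_singleton_le_iff_mem _ _).2 ha)
      · exact le_sup_right (a := B) (Submodule.mem_span_singleton_self a)
    rw [hJ] at h2
    exact Submodule.mem_one.2 h2
  have hJI : J ≤ q0Inv (toQ0 I) := by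
    intro y hy a ha
    obtain ⟨r, hr⟩ := Submodule.mem_one.1 (hA (Submodule.mul_mem_mul ha hy))
    exact ⟨r, by rw [mul_comm, hr]⟩
  -- `B` is an ideal `G` of `R`, and `G⁻¹ = R` says that `G` is a GV-ideal
  let G : Ideal R := Submodule.comap (Algebra.linearMap R (Q0 R)) B
  have hGB : toQ0 G = B := by
    refine Submodule.map_comap_eq_of_le fun x hx => ?_
    exact Submodule.mem_one.1 (hA (hBA hx))
  have hDG : D ≤ G := Submodule.map_le_iff_le_comap.1 hDB
  have hGfg : G.FG := by
    refine Submodule.fg_of_fg_map_injective (Algebra.linearMap R (Q0 R)) algebraMap_Q0_injective ?_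
    rw [show Submodule.map (Algebra.linearMap R (Q0 R)) G = B from hGB]
    exact hBfg
  have hGd : IsDenseIdeal R G := hD.isDenseIdeal.mono hDG
  have hG : IsGV R G := by
    refine isGV_iff.2 ⟨hGfg, hGd, fun φ => ?_⟩
    obtain ⟨x, hx⟩ := hGd.exists_smul_eq hGfg φ
    obtain ⟨r, hr⟩ := h1 x (by
      rw [← hGB]
      exact mem_q0Inv_toQ0.2 fun a ha => ⟨_, hx ⟨a, ha⟩⟩)
    refine ⟨r, fun a => algebraMap_Q0_injective ?_⟩
    rw [← hx, map_mul, ← hr, one_mul, Algebra.smul_def, mul_comm]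
  refine isWInvertible_iff.2 ⟨G, hG, fun g hg => ?_⟩
  rw [← Algebra.algebraMap_eq_smul_one]
  exact Submodule.mul_le.2 (fun a ha x hx => Submodule.mul_mem_mul ha (hJI hx)) (hBA hg)

/-- A finitely generated dense ideal `I` is `w`-invertible if and only if its identity is, up to
GV-ideals, a homomorphism of finite rank: an element `∑ aᵢ xᵢ` of `I I⁻¹` is the same as a
homomorphism `I → R^n → I` that is multiplication by an element of `R`. -/
theorem isWInvertible_iff_id_mem {I : Ideal R} (hfg : I.FG) (hI : IsDenseIdeal R I) :
    IsWInvertible I ↔ LinearMap.id ∈ gvFiniteRank R I I := by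
  rw [isWInvertible_iff]
  constructor
  · rintro ⟨J, hJ, h⟩
    have key : ∀ z ∈ toQ0 I * q0Inv (toQ0 I), ∃ φ ∈ finiteRank R I I,
        ∀ b : I, (b : R) • z = algebraMap R (Q0 R) (φ b) := by
      intro z hz
      induction hz using Submodule.mul_induction_on' with
      | mem_mul_mem a ha x hx =>
        obtain ⟨a, ha, rfl⟩ := ha
        obtain ⟨φ, hφ⟩ := exists_linearMap_of_mem_q0Inv hx
        refine ⟨φ.smulRight ⟨a, ha⟩, smulRight_mem_finiteRank _ _, fun b => ?_⟩
        rw [← mul_smul_comm, hφ, mul_comm]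
        exact (map_mul _ _ _).symm
      | add z _ z' _ h₁ h₂ =>
        obtain ⟨φ, hφ, h₁⟩ := h₁
        obtain ⟨φ', hφ', h₂⟩ := h₂
        refine ⟨φ + φ', add_mem hφ hφ', fun b => ?_⟩
        rw [smul_add, h₁, h₂, ← map_add]
        rfl
    refine ⟨J, hJ, fun j hj => ?_⟩
    obtain ⟨φ, hφ, h'⟩ := key _ (h j hj)
    have : j • LinearMap.id = φ := by
      ext b
      apply algebraMap_Q0_injective
      rw [← h', smul_comm, ← Algebra.algebraMap_eq_smul_one]
      exact map_smul (Algebra.linearMap R (Q0 R)) j (b : R)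
    rwa [this]
  · rintro ⟨J, hJ, h⟩
    have key : ∀ φ ∈ finiteRank R I I, ∃ z ∈ toQ0 I * q0Inv (toQ0 I),
        ∀ b : I, (b : R) • z = algebraMap R (Q0 R) (φ b) := by
      intro φ hφ
      induction hφ using Submodule.span_induction with
      | mem φ hφ =>
        obtain ⟨f, a, rfl⟩ := hφ
        obtain ⟨x, hx⟩ := hI.exists_smul_eq hfg f
        refine ⟨algebraMap R (Q0 R) a * x, Submodule.mul_mem_mul ⟨a, a.2, rfl⟩
          (mem_q0Inv_toQ0.2 fun b hb => ⟨_, hx ⟨b, hb⟩⟩), fun b => ?_⟩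
        rw [← mul_smul_comm, hx, mul_comm]
        exact (map_mul _ _ _).symm
      | zero => exact ⟨0, zero_mem _, by simp⟩
      | add φ φ' _ _ h₁ h₂ =>
        obtain ⟨z, hz, h₁⟩ := h₁
        obtain ⟨z', hz', h₂⟩ := h₂
        refine ⟨z + z', add_mem hz hz', fun b => ?_⟩
        rw [smul_add, h₁, h₂, ← map_add]
        rfl
      | smul c φ _ h =>
        obtain ⟨z, hz, h⟩ := h
        refine ⟨c • z, Submodule.smul_mem _ c hz, fun b => ?_⟩
        rw [smul_comm, h, Algebra.smul_def, ← map_mul]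
        rfl
    refine ⟨J, hJ, fun j hj => ?_⟩
    obtain ⟨z, hz, h'⟩ := key _ (h j hj)
    have : j • 1 = z := by
      refine hI.eq_of_forall_smul fun b hb => ?_
      rw [h' ⟨b, hb⟩, smul_comm, ← Algebra.algebraMap_eq_smul_one, Algebra.smul_def, ← map_mul]
      rfl
    rwa [this]

theorem isQ0PvMR_iff_isWInvertible :
    IsQ0PvMR R ↔ ∀ I : Ideal R, I.FG → IsSemiregularIdeal R I → IsWInvertible I :=
  ⟨fun h I h₁ h₂ => (h I h₁ h₂).isWInvertible, fun h I h₁ h₂ => (h I h₁ h₂).isTInvertible⟩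

end FiniteFractions

/-! ### Tor and flatness -/

section Tor

open TensorProduct

/-- For a complex `S` of modules, `H(S)` is GV-torsion if and only if every cycle is a boundary up
to a GV-ideal. -/
theorem isGVTorsion_homology_iff (S : ShortComplex (ModuleCat.{u} R)) :
    IsGVTorsion R S.homology ↔
      ∀ x : S.X₂, S.g.hom x = 0 → x ∈ gvClosure R (LinearMap.range S.f.hom) := by
  let e : S.homology ≃ₗ[R]
      (LinearMap.ker S.g.hom ⧸ LinearMap.range S.moduleCatToCycles) :=
    S.moduleCatHomologyIso.toLinearEquiv
  have h1 : IsGVTorsion R S.homology ↔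
      ∀ x, x ∈ gvTor R (LinearMap.ker S.g.hom ⧸ LinearMap.range S.moduleCatToCycles) := by
    rw [IsGVTorsion, Submodule.eq_top_iff']
    constructor
    · intro h x
      simpa using apply_mem_gvTor e.toLinearMap (h (e.symm x))
    · intro h x
      simpa using apply_mem_gvTor e.symm.toLinearMap (h (e x))
  have h2 : LinearMap.range S.moduleCatToCycles =
      (LinearMap.range S.f.hom).comap (LinearMap.ker S.g.hom).subtype := by
    ext x
    constructor
    · rintro ⟨y, rfl⟩
      exact ⟨y, rfl⟩
    · rintro ⟨y, hy⟩
      exact ⟨y, Subtype.ext hy⟩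
  rw [h1, (Submodule.mkQ_surjective _).forall]
  simp only [mkQ_mem_gvTor_iff]
  rw [h2]
  simp only [← apply_mem_gvClosure_iff]
  exact ⟨fun h x hx => h ⟨x, hx⟩, fun h x => h x x.2⟩

variable {E F G M : Type u} [AddCommGroup E] [Module R E] [AddCommGroup F] [Module R F]
  [AddCommGroup G] [Module R G] [AddCommGroup M] [Module R M]

theorem quotient_one_tmul_eq_zero_iff (I : Ideal R) (x : E) :
    (1 : R ⧸ I) ⊗ₜ[R] x = 0 ↔ x ∈ I • (⊤ : Submodule R E) := by
  rw [← (TensorProduct.quotTensorEquivQuotSMul E I).map_eq_zero_iff]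
  have : (TensorProduct.quotTensorEquivQuotSMul E I) ((1 : R ⧸ I) ⊗ₜ[R] x) =
      Submodule.Quotient.mk x := by
    have := TensorProduct.quotTensorEquivQuotSMul_mk_tmul I (1 : R) x
    rw [one_smul] at this
    exact this
  rw [this, Submodule.Quotient.mk_eq_zero]

variable (E) in
/-- The multiplication map `I ⊗ E → E`. -/
noncomputable def idealTensorMul (I : Ideal R) : I ⊗[R] E →ₗ[R] E :=
  (TensorProduct.lid R E).toLinearMap ∘ₗ LinearMap.rTensor E (Submodule.subtype I)

@[simp]
theorem idealTensorMul_tmul (I : Ideal R) (a : I) (x : E) :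
    idealTensorMul E I (a ⊗ₜ x) = (a : R) • x := rfl

theorem ker_idealTensorMul (I : Ideal R) : LinearMap.ker (idealTensorMul E I) =
    LinearMap.ker (LinearMap.rTensor E (Submodule.subtype I)) :=
  LinearMap.ker_comp_of_ker_eq_bot _ (LinearEquiv.ker _)

theorem range_idealTensorMul (I : Ideal R) :
    LinearMap.range (idealTensorMul E I) = I • (⊤ : Submodule R E) := by
  refine le_antisymm ?_ (Submodule.smul_le.2 fun a ha x _ => ⟨(⟨a, ha⟩ : I) ⊗ₜ x, rfl⟩)
  rintro _ ⟨z, rfl⟩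
  induction z using TensorProduct.induction_on with
  | zero => simp
  | tmul a x => exact Submodule.smul_mem_smul a.2 trivial
  | add z z' h h' =>
    rw [map_add]
    exact add_mem h h'

theorem idealTensorMul_naturality (I : Ideal R) (f : E →ₗ[R] F) (z : I ⊗[R] E) :
    idealTensorMul F I (f.lTensor I z) = f (idealTensorMul E I z) := by
  induction z using TensorProduct.induction_on with
  | zero => simp
  | tmul a x => simp
  | add z z' h h' => simp only [map_add, h, h']

/-- The comparison of `Tor₁(R/I, M)`, computed from the start `E → F → G → M → 0` of a flat
resolution, with the kernel of `I ⊗ M → M`, up to GV-torsion. -/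
theorem cycles_le_gvClosure_boundaries_iff (I : Ideal R) [Module.Flat R G] (d₂ : E →ₗ[R] F)
    (d₁ : F →ₗ[R] G) (ε : G →ₗ[R] M) (h₂ : Function.Exact d₂ d₁) (h₁ : Function.Exact d₁ ε)
    (hε : Function.Surjective ε) :
    (∀ x, d₁.lTensor (R ⧸ I) x = 0 → x ∈ gvClosure R (LinearMap.range (d₂.lTensor (R ⧸ I)))) ↔
      IsWMono (LinearMap.rTensor M (Submodule.subtype I)) := by
  -- both sides say that `d₁ F ∩ I G` is contained in the closure of `I d₁ F`
  trans ∀ p : F, d₁ p ∈ I • (⊤ : Submodule R G) →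
    d₁ p ∈ gvClosure R ((I • (⊤ : Submodule R F)).map d₁)
  · have hsurj : Function.Surjective (TensorProduct.mk R (R ⧸ I) F 1) :=
      TensorProduct.mk_surjective R F (R ⧸ I) Ideal.Quotient.mk_surjective
    have hsurj' : Function.Surjective (TensorProduct.mk R (R ⧸ I) E 1) :=
      TensorProduct.mk_surjective R E (R ⧸ I) Ideal.Quotient.mk_surjective
    have hrange : ∀ p : F, (1 : R ⧸ I) ⊗ₜ[R] p ∈ LinearMap.range (d₂.lTensor (R ⧸ I)) ↔
        d₁ p ∈ (I • (⊤ : Submodule R F)).map d₁ := by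
      intro p
      constructor
      · rintro ⟨z, hz⟩
        obtain ⟨q, rfl⟩ := hsurj' z
        rw [TensorProduct.mk_apply, LinearMap.lTensor_tmul, eq_comm, ← sub_eq_zero,
          ← TensorProduct.tmul_sub, quotient_one_tmul_eq_zero_iff] at hz
        refine ⟨_, hz, ?_⟩
        rw [map_sub, h₂.apply_apply_eq_zero, sub_zero]
      · rintro ⟨u, hu, hup⟩
        obtain ⟨q, hq⟩ := (h₂ (p - u)).1 (by rw [map_sub, hup, sub_self])
        refine ⟨1 ⊗ₜ q, ?_⟩
        rw [LinearMap.lTensor_tmul, hq, TensorProduct.tmul_sub,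
          (quotient_one_tmul_eq_zero_iff I u).2 hu, sub_zero]
    rw [hsurj.forall]
    refine forall_congr' fun p => ?_
    rw [TensorProduct.mk_apply, LinearMap.lTensor_tmul, quotient_one_tmul_eq_zero_iff]
    refine imp_congr_right fun _ => ?_
    simp only [mem_gvClosure, ← TensorProduct.tmul_smul, hrange, map_smul]
  · rw [isWMono_iff, ← ker_idealTensorMul]
    have hinj : Function.Injective (idealTensorMul G I) :=
      (TensorProduct.lid R G).injective.comp
        (Module.Flat.rTensor_preserves_injective_linearMap _ Subtype.val_injective)
    have hex := lTensor_exact I h₁ hε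
    constructor
    · intro h z hz
      obtain ⟨z, rfl⟩ := LinearMap.lTensor_surjective I hε z
      rw [LinearMap.mem_ker, idealTensorMul_naturality] at hz
      obtain ⟨p, hp⟩ := (h₁ _).1 hz
      obtain ⟨J, hJ, hj⟩ := h p (by
        rw [hp, ← range_idealTensorMul]
        exact ⟨z, rfl⟩)
      refine ⟨J, hJ, fun j hjJ => ?_⟩
      obtain ⟨u, hu, huj⟩ := hj j hjJ
      rw [SetLike.mem_coe, ← range_idealTensorMul] at hu
      obtain ⟨w, rfl⟩ := hu
      rw [← idealTensorMul_naturality, hp, ← map_smul] at huj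
      rw [Submodule.mem_bot, ← map_smul, ← hinj huj]
      exact hex.apply_apply_eq_zero w
    · intro h p hp
      rw [← range_idealTensorMul] at hp
      obtain ⟨z, hz⟩ := hp
      obtain ⟨J, hJ, hj⟩ := h (x := ε.lTensor I z) (by
        rw [LinearMap.mem_ker, idealTensorMul_naturality, hz, h₁.apply_apply_eq_zero])
      refine ⟨J, hJ, fun j hjJ => ?_⟩
      have h3 := hj j hjJ
      rw [Submodule.mem_bot, ← map_smul] at h3
      obtain ⟨w, hw⟩ := (hex _).1 h3
      refine ⟨idealTensorMul F I w, ?_, ?_⟩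
      · rw [SetLike.mem_coe, ← range_idealTensorMul]
        exact ⟨w, rfl⟩
      · rw [← idealTensorMul_naturality, hw, map_smul, hz]

theorem isGVTorsion_tor_iff (I : Ideal R) :
    IsGVTorsion R
      (((Tor (ModuleCat.{u} R) 1).obj (ModuleCat.of R (R ⧸ I))).obj (ModuleCat.of R M)) ↔
      IsWMono (LinearMap.rTensor M (Submodule.subtype I)) := by
  let P := ProjectiveResolution.of (ModuleCat.of R M)
  let K := (((MonoidalCategory.tensoringLeft (ModuleCat.{u} R)).obj
    (ModuleCat.of R (R ⧸ I))).mapHomologicalComplex _).obj P.complex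
  let e : ((Tor (ModuleCat.{u} R) 1).obj (ModuleCat.of R (R ⧸ I))).obj (ModuleCat.of R M) ≅
      (K.sc' 2 1 0).homology :=
    P.isoLeftDerivedObj ((MonoidalCategory.tensoringLeft (ModuleCat.{u} R)).obj
      (ModuleCat.of R (R ⧸ I))) 1 ≪≫
      ShortComplex.homologyMapIso (K.isoSc' 2 1 0 (by simp) (by simp))
  have h1 : IsGVTorsion R
      (((Tor (ModuleCat.{u} R) 1).obj (ModuleCat.of R (R ⧸ I))).obj (ModuleCat.of R M)) ↔
      IsGVTorsion R (K.sc' 2 1 0).homology := by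
    rw [IsGVTorsion, IsGVTorsion, Submodule.eq_top_iff', Submodule.eq_top_iff']
    constructor
    · intro h x
      simpa using apply_mem_gvTor e.toLinearEquiv.toLinearMap (h (e.toLinearEquiv.symm x))
    · intro h x
      simpa using apply_mem_gvTor e.toLinearEquiv.symm.toLinearMap (h (e.toLinearEquiv x))
  rw [h1, isGVTorsion_homology_iff]
  have : Module.Projective R (P.complex.X 0) :=
    (IsProjective.iff_projective _).2 (P.projective 0)
  let ε : P.complex.X 0 ⟶ ModuleCat.of R M := P.π.f 0
  have hε : Epi ε := inferInstanceAs (Epi (P.π.f 0))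
  have hex : (ShortComplex.mk (P.complex.d 1 0) ε P.complex_d_comp_π_f_zero).Exact := P.exact₀
  exact cycles_le_gvClosure_boundaries_iff I (P.complex.d 2 1).hom (P.complex.d 1 0).hom ε.hom
    ((ShortComplex.ShortExact.moduleCat_exact_iff_function_exact _).1 (P.exact_succ 0))
    ((ShortComplex.ShortExact.moduleCat_exact_iff_function_exact _).1 hex)
    ((ModuleCat.epi_iff_surjective ε).1 hε)

theorem isSrWFlat_iff : IsSrWFlat R M ↔ ∀ I : Ideal R, I.FG → IsSemiregularIdeal R I →
    IsWMono (LinearMap.rTensor M (Submodule.subtype I)) := by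
  simp only [IsSrWFlat, isGVTorsion_tor_iff]

end Tor

section WFlat

open TensorProduct

variable {E F M : Type u} [AddCommGroup E] [Module R E] [AddCommGroup F] [Module R F]
  [AddCommGroup M] [Module R M]

theorem isWMono_of_injective {f : E →ₗ[R] F} (hf : Function.Injective f) : IsWMono f := by
  rw [isWMono_iff, LinearMap.ker_eq_bot.2 hf]
  exact bot_le

theorem isWFlat_of_flat [Module.Flat R M] : IsWFlat R M := by
  intro A B _ _ _ _ f hf
  rw [isWMono_iff] at *
  have hex : Function.Exact ((LinearMap.ker f).subtype.rTensor M) (f.rTensor M) :=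
    Module.Flat.rTensor_exact M (LinearMap.exact_subtype_ker_map f)
  intro z hz
  obtain ⟨t, rfl⟩ := (hex z).1 hz
  clear hz
  induction t using TensorProduct.induction_on with
  | zero => simp
  | tmul a x => exact apply_mem_gvTor ((TensorProduct.mk R A M).flip x) (hf a.2)
  | add t t' h h' =>
    rw [map_add]
    exact add_mem h h'

theorem isWFlat_of_id_mem (h : LinearMap.id ∈ gvFiniteRank R M M) : IsWFlat R M := by
  intro A B _ _ _ _ f hf
  rw [isWMono_iff] at *
  obtain ⟨J, hJ, h⟩ := h
  intro z hz
  have key : ∀ φ ∈ finiteRank R M M, φ.lTensor A z ∈ gvTor R (A ⊗[R] M) := by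
    intro φ hφ
    induction hφ using Submodule.span_induction with
    | mem φ hφ =>
      obtain ⟨g, y, rfl⟩ := hφ
      -- the map factors through `A ⊗ R = A`, where `f ⊗ R` is `f`
      let a : A := TensorProduct.rid R A (g.lTensor A z)
      have h1 : (g.smulRight y).lTensor A z = a ⊗ₜ y := by
        clear hz
        induction z using TensorProduct.induction_on with
        | zero => simp [a]
        | tmul a x => simp [a, TensorProduct.smul_tmul]
        | add z z' h h' => simp only [map_add, a, h, h', TensorProduct.add_tmul]
      have h2 : f a = TensorProduct.rid R B (g.lTensor B (f.rTensor M z)) := by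
        clear hz h1
        induction z using TensorProduct.induction_on with
        | zero => simp [a]
        | tmul a x => simp [a]
        | add z z' h h' => simp only [map_add, a, h, h']
      rw [LinearMap.mem_ker.1 hz, map_zero, map_zero] at h2
      rw [h1]
      exact apply_mem_gvTor ((TensorProduct.mk R A M).flip y) (hf h2)
    | zero => simp
    | add φ ψ _ _ h₁ h₂ =>
      rw [LinearMap.lTensor_add]
      exact add_mem h₁ h₂
    | smul c φ _ h =>
      rw [LinearMap.lTensor_smul]
      exact Submodule.smul_mem _ c h
  refine mem_gvClosure_of_forall_smul_mem hJ fun j hj => ?_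
  have := key _ (h j hj)
  rwa [LinearMap.lTensor_smul, LinearMap.lTensor_id] at this

theorem IsWFlat.isSrWFlat (h : IsWFlat R M) : IsSrWFlat R M :=
  isSrWFlat_iff.2 fun _ _ _ => h _ _ _ (isWMono_of_injective Subtype.val_injective)

/-- If the finitely generated semi-regular ideals are `w`-flat, then `I ⊗ N → I ⊗ M → M` is a
`w`-monomorphism for every submodule `N` of a semi-regular `w`-flat module `M`. -/
theorem IsSrWFlat.submodule (hR : ∀ I : Ideal R, I.FG → IsSemiregularIdeal R I → IsWFlat R I)
    (hM : IsSrWFlat R M) (N : Submodule R M) : IsSrWFlat R N := by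
  refine isSrWFlat_iff.2 fun I h₁ h₂ => ?_
  have hM' := isSrWFlat_iff.1 hM I h₁ h₂
  have hN := hR I h₁ h₂ _ _ N.subtype (isWMono_of_injective N.injective_subtype)
  rw [isWMono_iff] at *
  rw [← ker_idealTensorMul] at *
  intro z hz
  obtain ⟨J, hJ, hj⟩ := hM' (x := N.subtype.lTensor I z) (by
    rw [LinearMap.mem_ker, idealTensorMul_naturality, LinearMap.mem_ker.1 hz, map_zero])
  refine mem_gvClosure_of_forall_smul_mem hJ fun j hjJ => ?_
  have h3 := hj j hjJ
  rw [Submodule.mem_bot, ← map_smul] at h3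
  have h4 : TensorProduct.comm R I N (j • z) ∈ gvTor R (N ⊗[R] I) := by
    refine hN ?_
    rw [LinearMap.mem_ker, LinearMap.rTensor_comm, h3, map_zero]
  have h5 := apply_mem_gvTor (TensorProduct.comm R I N).symm.toLinearMap h4
  rwa [LinearEquiv.coe_coe, LinearEquiv.symm_apply_apply] at h5

end WFlat

/-! ### Locally principal ideals -/

section LocallyCyclic

open TensorProduct

variable {M : Type u} [AddCommGroup M] [Module R M]

theorem exists_forall_smul_mem_of_finite [Module.Finite R M] (m : Ideal R) [m.IsPrime]
    (N : Submodule R M) (h : ∀ x : M, ∃ s ∉ m, s • x ∈ N) : ∃ s ∉ m, ∀ x : M, s • x ∈ N := by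
  classical
  obtain ⟨S, hS⟩ := (Module.finite_def (R := R) (M := M)).1 inferInstance
  choose g hg hg' using h
  refine ⟨∏ x ∈ S, g x, ?_, fun x => ?_⟩
  · rw [Ideal.IsPrime.prod_mem_iff]
    rintro ⟨x, -, hx⟩
    exact hg x hx
  · have hx : x ∈ Submodule.span R (S : Set M) := by rw [hS]; trivial
    have hle : Submodule.span R (S : Set M) ≤ N.comap (LinearMap.lsmul R M (∏ x ∈ S, g x)) := by
      rw [Submodule.span_le]
      intro y hy
      change (∏ x ∈ S, g x) • y ∈ N
      rw [← Finset.prod_erase_mul S g hy, mul_smul]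
      exact N.smul_mem _ (hg' y)
    exact hle hx

/-- Nakayama's lemma at a prime ideal. -/
theorem exists_forall_smul_eq_zero_of_smul_mem [Module.Finite R M] (m : Ideal R) [m.IsPrime]
    {s : R} (hs : s ∉ m) (h : ∀ x : M, s • x ∈ m • (⊤ : Submodule R M)) :
    ∃ t ∉ m, ∀ x : M, t • x = 0 := by
  obtain ⟨p, hp, -, hcoeff, hp0⟩ :=
    LinearMap.exists_monic_and_natDegree_eq_and_coeff_mem_pow_and_aeval_eq_zero R
      (algebraMap R (Module.End R M) s) m (by
        rintro _ ⟨x, rfl⟩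
        exact h x)
  refine ⟨p.eval s, fun hps => ?_, fun x => ?_⟩
  · -- `p(s)` is congruent to a power of `s` modulo `m`
    rw [Polynomial.eval_eq_sum_range, Finset.sum_range_succ, hp.coeff_natDegree, one_mul] at hps
    refine hs (Ideal.IsPrime.mem_of_pow_mem inferInstance _ ((Ideal.add_mem_iff_right m
      (Ideal.sum_mem _ fun i hi => Ideal.mul_mem_right _ _ ?_)).1 hps))
    have hi' : p.natDegree - i ≠ 0 := by
      have := Finset.mem_range.1 hi
      omega
    exact Ideal.pow_le_self hi' (hcoeff i)
  · rw [Polynomial.aeval_algebraMap_apply] at hp0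
    exact LinearMap.congr_fun hp0 x

/-- An element on which all homomorphisms into the residue field at `m` vanish lies in `m M`
locally at `m`. -/
theorem exists_smul_mem_of_forall_eq_zero (m : Ideal R) [m.IsPrime] {x : M}
    (h : ∀ f : M →ₗ[R] FractionRing (R ⧸ m), f x = 0) :
    ∃ s ∉ m, s • x ∈ m • (⊤ : Submodule R M) := by
  let N : Submodule R M := m • ⊤
  let V := LocalizedModule (nonZeroDivisors (R ⧸ m)) (M ⧸ N)
  let v : M → V := fun y =>
    LocalizedModule.mkLinearMap (nonZeroDivisors (R ⧸ m)) (M ⧸ N) (Submodule.Quotient.mk y)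
  have hv : v x = 0 := by
    refine (Module.forall_dual_apply_eq_zero_iff (FractionRing (R ⧸ m)) (v x)).1 fun F => ?_
    refine h { toFun := fun y => F (v y), map_add' := fun y z => ?_, map_smul' := fun c y => ?_ }
    · rw [← map_add]
      congr 1
      exact map_add (LocalizedModule.mkLinearMap (nonZeroDivisors (R ⧸ m)) (M ⧸ N))
        (Submodule.Quotient.mk y) (Submodule.Quotient.mk z)
    · have : v (c • y) = algebraMap (R ⧸ m) (FractionRing (R ⧸ m)) (Ideal.Quotient.mk m c) • v y := by
        rw [algebraMap_smul]
        exact map_smul (LocalizedModule.mkLinearMap (nonZeroDivisors (R ⧸ m)) (M ⧸ N))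
          (Ideal.Quotient.mk m c) (Submodule.Quotient.mk y)
      rw [this, map_smul, smul_eq_mul, RingHom.id_apply, Algebra.smul_def,
        IsScalarTower.algebraMap_apply R (R ⧸ m)]
      rfl
  have hv' : (LocalizedModule.mk (Submodule.Quotient.mk x) 1 : V) = LocalizedModule.mk 0 1 := by
    rw [LocalizedModule.zero_mk]
    exact hv
  obtain ⟨c, hc⟩ := LocalizedModule.mk_eq.1 hv'
  obtain ⟨s, hs⟩ := Ideal.Quotient.mk_surjective (c : R ⧸ m)
  refine ⟨s, fun hsm => nonZeroDivisors.coe_ne_zero c ?_, ?_⟩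
  · rw [← hs]
    exact Ideal.Quotient.eq_zero_iff_mem.2 hsm
  · rw [one_smul, one_smul, smul_zero] at hc
    have h2 : (Submodule.Quotient.mk (s • x) : M ⧸ N) = 0 := by
      rw [← hc, Submonoid.smul_def, ← hs]
      rfl
    exact (Submodule.Quotient.mk_eq_zero N).1 h2

/-- If the symmetry of `M ⊗ M` is locally trivial at `m`, then `M` is locally cyclic at `m`: the
fibre of `M` at `m` has dimension at most one. -/
theorem exists_smul_mem_span_singleton_of_tmul_comm [Module.Finite R M] (m : Ideal R) [m.IsPrime]
    (h : ∀ a b : M, ∃ s ∉ m, s • (a ⊗ₜ[R] b) = s • (b ⊗ₜ[R] a)) :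
    ∃ a : M, ∃ s ∉ m, ∀ b : M, s • b ∈ Submodule.span R {a} := by
  have hcomm : ∀ (f g : M →ₗ[R] FractionRing (R ⧸ m)) (a b : M), f a * g b = f b * g a := by
    intro f g a b
    obtain ⟨s, hs, hab⟩ := h a b
    have h1 := congrArg (LinearMap.mul' R (FractionRing (R ⧸ m)) ∘ₗ TensorProduct.map f g) hab
    simp only [map_smul, LinearMap.comp_apply, TensorProduct.map_tmul, LinearMap.mul'_apply] at h1
    rw [← algebraMap_smul (R ⧸ m) s, ← algebraMap_smul (R ⧸ m) s] at h1
    have hs0 : algebraMap R (R ⧸ m) s ≠ 0 := fun h0 => hs (Ideal.Quotient.eq_zero_iff_mem.1 h0)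
    exact smul_right_injective (FractionRing (R ⧸ m)) hs0 h1
  by_cases h0 : ∀ (f : M →ₗ[R] FractionRing (R ⧸ m)) (a : M), f a = 0
  · obtain ⟨s, hs, hsx⟩ := exists_forall_smul_mem_of_finite m _ fun x =>
      exists_smul_mem_of_forall_eq_zero m (x := x) fun f => h0 f x
    obtain ⟨t, ht, htx⟩ := exists_forall_smul_eq_zero_of_smul_mem m hs hsx
    exact ⟨0, t, ht, fun b => by rw [htx]; exact zero_mem _⟩
  push Not at h0
  obtain ⟨f, a, hfa⟩ := h0
  have hb : ∀ b : M, ∃ s ∉ m, s • b ∈ Submodule.span R {a} ⊔ m • (⊤ : Submodule R M) := by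
    intro b
    obtain ⟨d, c, hc, hdc⟩ := IsFractionRing.div_surjective (A := R ⧸ m) (f b / f a)
    obtain ⟨d, rfl⟩ := Ideal.Quotient.mk_surjective d
    obtain ⟨c, rfl⟩ := Ideal.Quotient.mk_surjective c
    have hcm : c ∉ m := fun hcm => nonZeroDivisors.ne_zero hc (Ideal.Quotient.eq_zero_iff_mem.2 hcm)
    have hc0 : algebraMap (R ⧸ m) (FractionRing (R ⧸ m)) (Ideal.Quotient.mk m c) ≠ 0 :=
      IsFractionRing.to_map_ne_zero_of_mem_nonZeroDivisors hc
    have hsmul : ∀ (r : R) (z : FractionRing (R ⧸ m)),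
        r • z = algebraMap (R ⧸ m) (FractionRing (R ⧸ m)) (Ideal.Quotient.mk m r) * z := by
      intro r z
      rw [Algebra.smul_def, IsScalarTower.algebraMap_apply R (R ⧸ m)]
      rfl
    rw [div_eq_div_iff hc0 hfa] at hdc
    obtain ⟨e, he, hex⟩ := exists_smul_mem_of_forall_eq_zero m (x := c • b - d • a) fun g => by
      refine (mul_eq_zero.1 ?_).resolve_left hfa
      rw [map_sub, map_smul, map_smul, mul_sub, hsmul, hsmul]
      linear_combination (algebraMap (R ⧸ m) (FractionRing (R ⧸ m)) (Ideal.Quotient.mk m c)) *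
        hcomm f g a b - g a * hdc
    refine ⟨e * c, Ideal.IsPrime.mul_notMem inferInstance he hcm, ?_⟩
    have : (e * c) • b = (e * d) • a + e • (c • b - d • a) := by
      rw [smul_sub, mul_smul, mul_smul]
      abel
    rw [this]
    exact Submodule.add_mem_sup (Submodule.smul_mem _ _ (Submodule.mem_span_singleton_self a)) hex
  obtain ⟨s, hs, hsb⟩ := exists_forall_smul_mem_of_finite m _ hb
  obtain ⟨t, ht, htx⟩ := exists_forall_smul_eq_zero_of_smul_mem
    (M := M ⧸ Submodule.span R {a}) m hs (fun x => by
      obtain ⟨x, rfl⟩ := Submodule.mkQ_surjective _ x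
      have h1 := Submodule.mem_map_of_mem (f := (Submodule.span R {a}).mkQ) (hsb x)
      rw [Submodule.map_sup, Submodule.map_smul'', Submodule.mkQ_map_self, bot_sup_eq] at h1
      exact Submodule.smul_mono le_rfl le_top h1)
  refine ⟨a, t, ht, fun b => ?_⟩
  have := htx (Submodule.Quotient.mk b)
  rwa [← Submodule.Quotient.mk_smul, Submodule.Quotient.mk_eq_zero] at this

end LocallyCyclic

section Ideals

open TensorProduct

/-- If `s I ⊆ R a` with `a ∈ I`, then `s² = x a` for a homomorphism `x : I → R`. It sends `b` to
`s r` where `s b = r a`; this is well-defined because `s` annihilates the annihilator of `a`, as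
`I` is dense. -/
theorem IsDenseIdeal.sq_smul_id_mem_finiteRank {I : Ideal R} (hI : IsDenseIdeal R I) {s : R}
    {a : I} (h : ∀ b : I, s • b ∈ Submodule.span R {a}) :
    s ^ 2 • LinearMap.id ∈ finiteRank R I I := by
  have h' : ∀ b : I, ∃ r : R, r * a = s * b := fun b => by
    obtain ⟨r, hr⟩ := Submodule.mem_span_singleton.1 (h b)
    exact ⟨r, congrArg Subtype.val hr⟩
  have hann : ∀ r : R, r * a = 0 → s * r = 0 := by
    refine fun r hr => hI _ fun b hb => ?_
    obtain ⟨q, hq⟩ := h' ⟨b, hb⟩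
    rw [show b * (s * r) = (s * b) * r by ring, ← hq, mul_assoc, mul_comm (a : R), hr, mul_zero]
  choose g hg using h'
  have key : ∀ p q : R, p * a = q * a → s * p = s * q := fun p q hpq =>
    sub_eq_zero.1 (by rw [← mul_sub]; exact hann _ (by rw [sub_mul, hpq, sub_self]))
  let φ : I →ₗ[R] R :=
    { toFun := fun b => s * g b
      map_add' := fun b c => by
        rw [← mul_add]
        refine key _ _ ?_
        rw [add_mul, hg, hg, hg, Submodule.coe_add, mul_add]
      map_smul' := fun c b => by
        rw [RingHom.id_apply, smul_eq_mul, mul_left_comm]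
        refine key _ _ ?_
        rw [mul_assoc, hg, hg, Submodule.coe_smul, smul_eq_mul, mul_left_comm] }
  have : s ^ 2 • LinearMap.id = φ.smulRight a := by
    ext b
    change s ^ 2 * (b : R) = s * g b * a
    rw [mul_assoc, hg, sq, mul_assoc]
  rw [this]
  exact smulRight_mem_finiteRank _ _

theorem IsDenseIdeal.id_mem_gvFiniteRank_of_forall {I : Ideal R} (hI : IsDenseIdeal R I)
    (h : ∀ m : Ideal R, IsMaximalWIdeal R m →
      ∃ a : I, ∃ s ∉ m, ∀ b : I, s • b ∈ Submodule.span R {a}) :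
    LinearMap.id ∈ gvFiniteRank R I I := by
  refine mem_gvClosure_iff_forall_isMaximalWIdeal.2 fun m hm => ?_
  have := hm.isPrime
  obtain ⟨a, s, hs, hb⟩ := h m hm
  exact ⟨s ^ 2, fun hs2 => hs (Ideal.IsPrime.mem_of_pow_mem inferInstance _ hs2),
    hI.sq_smul_id_mem_finiteRank hb⟩

/-- `a ⊗ b` and `b ⊗ a` have the same image under the `w`-monomorphism `I ⊗ I → I`. -/
theorem exists_smul_tmul_eq_of_isWMono {I : Ideal R}
    (h : IsWMono (LinearMap.rTensor I (Submodule.subtype I))) {m : Ideal R}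
    (hm : IsMaximalWIdeal R m) (a b : I) : ∃ s ∉ m, s • (a ⊗ₜ[R] b) = s • (b ⊗ₜ[R] a) := by
  rw [isWMono_iff, ← ker_idealTensorMul] at h
  obtain ⟨s, hs, hab⟩ := mem_gvClosure_iff_forall_isMaximalWIdeal.1
    (h (x := a ⊗ₜ[R] b - b ⊗ₜ[R] a) (by
      rw [LinearMap.mem_ker, map_sub, idealTensorMul_tmul, idealTensorMul_tmul, sub_eq_zero]
      exact Subtype.ext (mul_comm _ _))) m hm
  exact ⟨s, hs, by rwa [Submodule.mem_bot, smul_sub, sub_eq_zero] at hab⟩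

theorem IsDenseIdeal.id_mem_gvFiniteRank_of_isWMono {I : Ideal R} (hfg : I.FG)
    (hI : IsDenseIdeal R I) (h : IsWMono (LinearMap.rTensor I (Submodule.subtype I))) :
    LinearMap.id ∈ gvFiniteRank R I I := by
  have : Module.Finite R I := Module.Finite.iff_fg.2 hfg
  refine hI.id_mem_gvFiniteRank_of_forall fun m hm => ?_
  have := hm.isPrime
  exact exists_smul_mem_span_singleton_of_tmul_comm m (exists_smul_tmul_eq_of_isWMono h hm)

end Ideals

/-! ### Projectivity, finite type and semi-regular modules -/

section Envelope

variable {E F G M L : Type u} [AddCommGroup E] [Module R E] [AddCommGroup F] [Module R F]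
  [AddCommGroup G] [Module R G] [AddCommGroup M] [Module R M] [AddCommGroup L] [Module R L]

theorem isGVIso_of_bijective {k : E →ₗ[R] F} (hk : Function.Bijective k) : IsGVIso k where
  ker_le := by
    rw [LinearMap.ker_eq_bot.2 hk.1]
    exact bot_le
  mem_closure y := le_gvClosure _ (hk.2 y)

variable (R M) in
theorem isGVTorsionFree_quotient_gvTor : IsGVTorsionFree R (M ⧸ gvTor R M) :=
  isGVTorsionFree_quotient_gvClosure ⊥

theorem gvTor_le_ker (hG : IsGVTorsionFree R G) (f : M →ₗ[R] G) :
    gvTor R M ≤ LinearMap.ker f := fun _ hx =>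
  isGVTorsionFree_iff.1 hG _ (apply_mem_gvTor f hx)

/-- A map from `M` to a GV-torsion-free module factors through `M / tor M`. -/
theorem mem_gvFiniteRank_of_mkQ_mem (h : (gvTor R M).mkQ ∈ gvFiniteRank R M (M ⧸ gvTor R M))
    (hG : IsGVTorsionFree R G) (f : M →ₗ[R] G) : f ∈ gvFiniteRank R M G := by
  have h1 := gvFiniteRank_comp h ((gvTor R M).liftQ f (gvTor_le_ker hG f)) LinearMap.id
  rwa [LinearMap.comp_id, Submodule.liftQ_mkQ] at h1

/-- A `w`-isomorphism `M → G` with `G` GV-torsion-free induces an injective `w`-isomorphism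
`M / tor M → G`. -/
theorem mkQ_mem_of_isGVIso {f : M →ₗ[R] G} (hf : IsGVIso f) (hG : IsGVTorsionFree R G)
    (h : f ∈ gvFiniteRank R M G) : (gvTor R M).mkQ ∈ gvFiniteRank R M (M ⧸ gvTor R M) := by
  let g := (gvTor R M).liftQ f (gvTor_le_ker hG f)
  have hg : g ∘ₗ (gvTor R M).mkQ = f := Submodule.liftQ_mkQ _ _ _
  have hinj : Function.Injective g := by
    rw [← LinearMap.ker_eq_bot]
    exact Submodule.ker_liftQ_eq_bot _ _ _ hf.ker_le
  refine mem_gvFiniteRank_of_comp_left (k := g) ⟨?_, fun y => ?_⟩ hinj (by rwa [hg])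
  · rw [LinearMap.ker_eq_bot.2 hinj]
    exact bot_le
  · have := hf.mem_closure y
    rwa [← Submodule.range_liftQ _ f (gvTor_le_ker hG f)] at this

theorem isGVTorsionFree_injectiveEnvelope (hM : IsGVTorsionFree R M) :
    IsGVTorsionFree R (injectiveEnvelope R M) := by
  have h := isInjectiveEnvelope_toInjectiveEnvelope R M
  refine h.essential _ ?_
  rw [eq_bot_iff]
  rintro _ ⟨⟨J, hJ, hx⟩, ⟨y, rfl⟩⟩
  have hy : y ∈ gvTor R M := ⟨J, hJ, fun j hj => h.injective_map (by
    rw [map_smul, map_zero]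
    exact hx j hj)⟩
  rw [isGVTorsionFree_iff.1 hM y hy, map_zero]
  exact zero_mem _

variable (R M) in
/-- The canonical map `M → (M / tor M)_w`. -/
noncomputable def toWEnvelope : M →ₗ[R] wEnvelope R (M ⧸ gvTor R M) :=
  (toInjectiveEnvelope R (M ⧸ gvTor R M) ∘ₗ (gvTor R M).mkQ).codRestrict _
    fun _ => le_gvClosure _ ⟨_, rfl⟩

variable (R M) in
theorem isGVTorsionFree_wEnvelope : IsGVTorsionFree R (wEnvelope R (M ⧸ gvTor R M)) :=
  (isGVTorsionFree_injectiveEnvelope (isGVTorsionFree_quotient_gvTor R M)).of_injective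
    (Submodule.subtype _) Subtype.val_injective

variable (R M) in
theorem isGVIso_toWEnvelope : IsGVIso (toWEnvelope R M) where
  ker_le x hx := by
    have h1 : toInjectiveEnvelope R (M ⧸ gvTor R M) ((gvTor R M).mkQ x) = 0 :=
      congrArg Subtype.val (LinearMap.mem_ker.1 hx)
    rw [← map_zero (toInjectiveEnvelope R (M ⧸ gvTor R M))] at h1
    exact (Submodule.Quotient.mk_eq_zero _).1
      ((isInjectiveEnvelope_toInjectiveEnvelope R (M ⧸ gvTor R M)).injective_map h1)
  mem_closure y := by
    obtain ⟨J, hJ, hy⟩ := y.2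
    refine ⟨J, hJ, fun j hj => ?_⟩
    obtain ⟨x, hx⟩ := hy j hj
    obtain ⟨x, rfl⟩ := Submodule.mkQ_surjective _ x
    exact ⟨x, Subtype.ext hx⟩

theorem isWProjective_of_mkQ_mem (h : (gvTor R M).mkQ ∈ gvFiniteRank R M (M ⧸ gvTor R M)) :
    IsWProjective R M := by
  intro N _ _ _ _
  refine isGVTorsion_ext_of_id_mem ?_
  refine mem_gvFiniteRank_of_comp (isGVIso_toWEnvelope R M) (isGVTorsionFree_wEnvelope R M) ?_
  exact mem_gvFiniteRank_of_mkQ_mem h (isGVTorsionFree_wEnvelope R M) _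

theorem exists_finset_support_subset [Module.Finite R M] {ι : Type u} (f : M →ₗ[R] (ι →₀ R)) :
    ∃ T : Finset ι, ∀ x, (f x).support ⊆ T := by
  classical
  obtain ⟨S, hS⟩ := (Module.finite_def (R := R) (M := M)).1 inferInstance
  refine ⟨S.biUnion fun x => (f x).support, fun x => ?_⟩
  have hle : Submodule.span R (S : Set M) ≤
      (Finsupp.supported R R ((S.biUnion fun x => (f x).support : Finset ι) : Set ι)).comap f := by
    rw [Submodule.span_le]
    intro y hy
    change f y ∈ Finsupp.supported R R _
    rw [Finsupp.mem_supported]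
    exact Finset.coe_subset.2 (Finset.subset_biUnion_of_mem (fun x => (f x).support) hy)
  have hx : x ∈ Submodule.span R (S : Set M) := by rw [hS]; trivial
  exact Finset.coe_subset.1 ((Finsupp.mem_supported R _).1 (hle hx))

theorem comp_mem_finiteRank_of_finite [Module.Finite R M] {ι : Type u} (f : M →ₗ[R] (ι →₀ R))
    (π : (ι →₀ R) →ₗ[R] L) : π ∘ₗ f ∈ finiteRank R M L := by
  obtain ⟨T, hT⟩ := exists_finset_support_subset f
  have : π ∘ₗ f = ∑ i ∈ T, (Finsupp.lapply i ∘ₗ f).smulRight (π (Finsupp.single i 1)) := by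
    ext x
    have h1 : f x = ∑ i ∈ T, f x i • Finsupp.single i (1 : R) := by
      conv_lhs => rw [← Finsupp.sum_single (f x)]
      rw [Finsupp.sum_of_support_subset _ (hT x) _ (by simp)]
      simp
    rw [LinearMap.comp_apply, h1, map_sum, LinearMap.sum_apply]
    refine Finset.sum_congr rfl fun i _ => ?_
    rw [map_smul]
    rfl
  rw [this]
  exact sum_mem fun i _ => smulRight_mem_finiteRank _ _

/-- The kernel of a map from a free module to a GV-torsion-free module is a `w`-module. -/
theorem isWModule_ker {ι : Type u} (hL : IsGVTorsionFree R L) (π : (ι →₀ R) →ₗ[R] L) :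
    IsWModule R (LinearMap.ker π) := by
  refine isWModule_iff.2 ⟨(isGVTorsionFree_finsupp ι).of_injective (Submodule.subtype _)
    Subtype.val_injective, fun J hJ φ => ?_⟩
  have : Module.Finite R J := Module.Finite.iff_fg.2 hJ.1
  obtain ⟨T, hT⟩ := exists_finset_support_subset (Submodule.subtype _ ∘ₗ φ)
  choose r hr using fun i => (isGV_iff.1 hJ).2.2
    (Finsupp.lapply i ∘ₗ Submodule.subtype (LinearMap.ker π) ∘ₗ φ)
  have hr' : ∀ i (j : J), (φ j : ι →₀ R) i = r i * j := hr
  have hrT : ∀ i, r i ≠ 0 → i ∈ T := by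
    intro i hi
    by_contra hiT
    refine hi ((isGV_iff.1 hJ).2.1 _ fun j hj => ?_)
    rw [mul_comm, ← hr' i ⟨j, hj⟩]
    by_contra h0
    exact hiT (hT ⟨j, hj⟩ (Finsupp.mem_support_iff.2 h0))
  let x : ι →₀ R := Finsupp.onFinset T r hrT
  have hx : ∀ j : J, (φ j : ι →₀ R) = (j : R) • x := by
    intro j
    ext i
    rw [hr', mul_comm]
    rfl
  have hx0 : π x = 0 := by
    refine hL.eq_of_forall_smul hJ fun j hj => ?_
    rw [← map_smul, ← hx ⟨j, hj⟩, smul_zero]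
    exact (φ ⟨j, hj⟩).2
  exact ⟨⟨x, hx0⟩, fun j => Subtype.ext (hx j)⟩

/-- For finitely generated modules, being `w`-projective means that, up to GV-ideals, the identity
factors through a finitely generated free module. The test module for `Ext¹` is the kernel of a
free presentation of `(M / tor M)_w`. -/
theorem IsWProjective.mkQ_mem [Module.Finite R M] (h : IsWProjective R M) :
    (gvTor R M).mkQ ∈ gvFiniteRank R M (M ⧸ gvTor R M) := by
  have htf := isGVTorsionFree_wEnvelope R M
  let π : (wEnvelope R (M ⧸ gvTor R M) →₀ R) →ₗ[R] wEnvelope R (M ⧸ gvTor R M) :=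
    Finsupp.linearCombination R id
  have hπ : Function.Surjective π := Finsupp.linearCombination_id_surjective R _
  obtain ⟨J, hJ, hs⟩ := exists_lift_of_isGVTorsion_ext π hπ
    (h (LinearMap.ker π) inferInstance (isWModule_ker htf π))
  refine mkQ_mem_of_isGVIso (isGVIso_toWEnvelope R M) htf ⟨J, hJ, fun j hj => ?_⟩
  obtain ⟨s, hs⟩ := hs j hj
  have : j • toWEnvelope R M = π ∘ₗ (s ∘ₗ toWEnvelope R M) := by
    ext x : 1
    exact (hs _).symm
  rw [this]
  exact comp_mem_finiteRank_of_finite _ _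

end Envelope

section FiniteType

variable {A C D M : Type u} [AddCommGroup A] [Module R A] [AddCommGroup C] [Module R C]
  [AddCommGroup D] [Module R D] [AddCommGroup M] [Module R M]

theorem isFiniteType_iff :
    IsFiniteType R M ↔ ∃ N : Submodule R M, N.FG ∧ ∀ x, x ∈ gvClosure R N := by
  simp only [IsFiniteType, isWEpi_iff]
  constructor
  · rintro ⟨n, g, hg⟩
    exact ⟨_, Module.Finite.iff_fg.1 (Module.Finite.range g), hg⟩
  · rintro ⟨N, hN, h⟩
    obtain ⟨n, b, hb⟩ := Submodule.fg_iff_exists_fin_generating_family.1 hN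
    refine ⟨n, Fintype.linearCombination R b, ?_⟩
    rwa [Fintype.range_linearCombination, hb]

theorem isFiniteType_of_finite [Module.Finite R M] : IsFiniteType R M :=
  isFiniteType_iff.2 ⟨⊤, Module.Finite.fg_top, fun _ => le_gvClosure _ trivial⟩

theorem IsFiniteType.of_mem_closure_range (h : IsFiniteType R C) (f : C →ₗ[R] D)
    (hf : ∀ y, y ∈ gvClosure R (LinearMap.range f)) : IsFiniteType R D := by
  obtain ⟨N, hN, h⟩ := isFiniteType_iff.1 h
  refine isFiniteType_iff.2 ⟨N.map f, hN.map f, fun y => ?_⟩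
  obtain ⟨J, hJ, hy⟩ := hf y
  refine mem_gvClosure_of_forall_smul_mem hJ fun j hj => ?_
  obtain ⟨x, hx⟩ := hy j hj
  rw [← hx]
  exact apply_mem_gvClosure_map f (h x)

theorem exists_lift_finiteRank {g : C →ₗ[R] D} (hg : Function.Surjective g) {φ : A →ₗ[R] D}
    (hφ : φ ∈ finiteRank R A D) : ∃ ψ ∈ finiteRank R A C, g ∘ₗ ψ = φ := by
  induction hφ using Submodule.span_induction with
  | mem φ hφ =>
    obtain ⟨f, y, rfl⟩ := hφ
    obtain ⟨x, rfl⟩ := hg y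
    exact ⟨f.smulRight x, smulRight_mem_finiteRank _ _, by ext; simp⟩
  | zero => exact ⟨0, zero_mem _, by simp⟩
  | add φ₁ φ₂ _ _ h₁ h₂ =>
    obtain ⟨ψ₁, h₁, rfl⟩ := h₁
    obtain ⟨ψ₂, h₂, rfl⟩ := h₂
    exact ⟨_, add_mem h₁ h₂, LinearMap.comp_add _ _ _⟩
  | smul c φ _ h =>
    obtain ⟨ψ, h, rfl⟩ := h
    exact ⟨_, Submodule.smul_mem _ c h, LinearMap.comp_smul _ _ _⟩

/-- Let `M / N` be of finite rank up to GV-torsion, and let `N'` be the closure of `N`. Up to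
GV-ideals, `M` retracts onto `N'`: modulo a map of finite rank, `j • id` maps `M` to `N'`, for all
`j` in a suitable GV-ideal. -/
theorem exists_retraction (N : Submodule R M)
    (h : (gvTor R (M ⧸ N)).mkQ ∈ gvFiniteRank R (M ⧸ N) ((M ⧸ N) ⧸ gvTor R (M ⧸ N))) :
    ∃ J : Ideal R, IsGV R J ∧ ∀ j ∈ J, ∃ (u : M →ₗ[R] gvClosure R N) (ψ : M →ₗ[R] M),
      ψ ∈ finiteRank R M M ∧ (∀ x, (u x : M) + ψ x = j • x) ∧ ∀ x ∈ gvClosure R N, ψ x = 0 := by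
  have htf := isGVTorsionFree_quotient_gvClosure N
  let ρ : (M ⧸ N) →ₗ[R] (M ⧸ gvClosure R N) := Submodule.factor (le_gvClosure N)
  have hρ : IsGVIso ρ := by
    refine ⟨fun x hx => ?_, fun y => le_gvClosure _ ?_⟩
    · obtain ⟨x, rfl⟩ := Submodule.mkQ_surjective _ x
      exact mkQ_mem_gvTor_iff.2 ((Submodule.Quotient.mk_eq_zero _).1 hx)
    · obtain ⟨y, rfl⟩ := Submodule.mkQ_surjective _ y
      exact ⟨N.mkQ y, rfl⟩
  obtain ⟨J, hJ, hj⟩ := mem_gvFiniteRank_of_comp (φ := LinearMap.id) hρ htf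
    (mem_gvFiniteRank_of_mkQ_mem h htf _)
  refine ⟨J, hJ, fun j hjJ => ?_⟩
  obtain ⟨ψ, hψ, hψj⟩ := exists_lift_finiteRank (Submodule.mkQ_surjective (gvClosure R N)) (hj j hjJ)
  have hmem : ∀ x, j • x - ψ ((gvClosure R N).mkQ x) ∈ gvClosure R N := by
    intro x
    rw [← Submodule.Quotient.mk_eq_zero, ← Submodule.mkQ_apply, map_sub, map_smul, sub_eq_zero]
    exact (LinearMap.congr_fun hψj _).symm
  refine ⟨(j • LinearMap.id - ψ ∘ₗ (gvClosure R N).mkQ).codRestrict _ hmem,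
    ψ ∘ₗ (gvClosure R N).mkQ, finiteRank_comp hψ LinearMap.id _, fun x => sub_add_cancel _ _,
    fun x hx => ?_⟩
  rw [LinearMap.comp_apply, Submodule.mkQ_apply, (Submodule.Quotient.mk_eq_zero _).2 hx, map_zero]

/-- If `M` is of finite type and `M / N` is of finite rank up to GV-torsion, then `N` is of finite
type: the retractions of `M` onto the closure of `N` preserve finite generation. -/
theorem IsFiniteType.of_quotient (hM : IsFiniteType R M) (N : Submodule R M)
    (h : (gvTor R (M ⧸ N)).mkQ ∈ gvFiniteRank R (M ⧸ N) ((M ⧸ N) ⧸ gvTor R (M ⧸ N)))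
    (i : A →ₗ[R] M) (hi : Function.Injective i) (hiN : LinearMap.range i = N) :
    IsFiniteType R A := by
  obtain ⟨P, hP, hPM⟩ := isFiniteType_iff.1 hM
  obtain ⟨J, hJ, hj⟩ := exists_retraction N h
  choose! u ψ _ huψ hψ using hj
  obtain ⟨S, hS⟩ := hJ.1
  have hSJ : ∀ j ∈ S, j ∈ J := fun j hj => by
    rw [← hS]
    exact Submodule.subset_span hj
  -- the retractions carry generators of `M` to generators of the closure of `N`
  let P' : Submodule R M := ⨆ j ∈ S, P.map ((gvClosure R N).subtype ∘ₗ u j)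
  have hP'fg : P'.FG := Submodule.fg_biSup S _ fun j _ => hP.map _
  have hP'N : P' ≤ gvClosure R N := by
    refine iSup₂_le fun j _ => ?_
    rintro _ ⟨x, -, rfl⟩
    exact (u j x).2
  have hNP' : ∀ a ∈ gvClosure R N, a ∈ gvClosure R P' := by
    intro a ha
    refine mem_gvClosure_of_forall_smul_mem hJ fun j hj => ?_
    have hle : J ≤ (gvClosure R P').comap (LinearMap.toSpanSingleton R M a) := by
      rw [← hS, Submodule.span_le]
      intro j hj
      change j • a ∈ gvClosure R P'
      rw [← huψ j (hSJ j hj) a, hψ j (hSJ j hj) a ha, add_zero]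
      exact gvClosure_mono (le_iSup₂_of_le j hj le_rfl)
        (apply_mem_gvClosure_map ((gvClosure R N).subtype ∘ₗ u j) (hPM a))
    exact hle hj
  obtain ⟨J', hJ', hJN⟩ := exists_isGV_smul_le hP'fg hP'N
  have hcomap : ((J' • P').comap i).map i = J' • P' :=
    Submodule.map_comap_eq_of_le (by rwa [hiN])
  refine isFiniteType_iff.2 ⟨(J' • P').comap i, ?_, fun x => ?_⟩
  · refine Submodule.fg_of_fg_map_injective i hi ?_
    rw [hcomap]
    exact Submodule.FG.smul hJ'.1 hP'fg
  · rw [← apply_mem_gvClosure_iff]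
    have hx : i x ∈ gvClosure R P' := hNP' _ (le_gvClosure _ (by rw [← hiN]; exact ⟨x, rfl⟩))
    obtain ⟨J₁, hJ₁, h₁⟩ := hx
    exact mem_gvClosure_of_forall_smul_mem hJ₁ fun j hj =>
      ⟨J', hJ', fun j' hj' => Submodule.smul_mem_smul hj' (h₁ j hj)⟩

theorem mkQ_mem_of_extension (N : Submodule R M)
    (h : (gvTor R (M ⧸ N)).mkQ ∈ gvFiniteRank R (M ⧸ N) ((M ⧸ N) ⧸ gvTor R (M ⧸ N)))
    (i : A →ₗ[R] M) (hi : Function.Injective i) (hiN : LinearMap.range i = N)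
    (hA : (gvTor R A).mkQ ∈ gvFiniteRank R A (A ⧸ gvTor R A)) :
    (gvTor R M).mkQ ∈ gvFiniteRank R M (M ⧸ gvTor R M) := by
  have htf := isGVTorsionFree_quotient_gvTor R M
  obtain ⟨J, hJ, hj⟩ := exists_retraction N h
  let i' : A →ₗ[R] gvClosure R N :=
    i.codRestrict _ fun x => le_gvClosure _ (by rw [← hiN]; exact ⟨x, rfl⟩)
  have hi' : IsGVIso i' := by
    refine ⟨?_, fun y => ?_⟩
    · rw [LinearMap.ker_codRestrict, LinearMap.ker_eq_bot.2 hi]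
      exact bot_le
    · obtain ⟨J, hJ, hy⟩ := y.2
      refine ⟨J, hJ, fun j hj => ?_⟩
      obtain ⟨x, hx⟩ := hiN.ge (hy j hj)
      exact ⟨x, Subtype.ext hx⟩
  have h1 : (gvTor R M).mkQ ∘ₗ (gvClosure R N).subtype ∈ gvFiniteRank R _ (M ⧸ gvTor R M) :=
    mem_gvFiniteRank_of_comp hi' htf (mem_gvFiniteRank_of_mkQ_mem hA htf _)
  refine mem_gvClosure_of_forall_smul_mem hJ fun j hjJ => ?_
  obtain ⟨u, ψ, hψ, huψ, -⟩ := hj j hjJ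
  have : j • (gvTor R M).mkQ =
      LinearMap.id ∘ₗ ((gvTor R M).mkQ ∘ₗ (gvClosure R N).subtype) ∘ₗ u +
        (gvTor R M).mkQ ∘ₗ ψ ∘ₗ LinearMap.id := by
    ext x : 1
    rw [LinearMap.smul_apply, ← map_smul, ← huψ, map_add]
    rfl
  rw [this]
  exact add_mem (gvFiniteRank_comp h1 _ _) (le_gvClosure _ (finiteRank_comp hψ _ _))

/-- An ideal of finite type has the same closure as a finitely generated subideal, which can be
taken semi-regular. -/
theorem id_mem_gvFiniteRank_of_isFiniteType
    (hR : ∀ I : Ideal R, I.FG → IsSemiregularIdeal R I → LinearMap.id ∈ gvFiniteRank R I I)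
    {I : Ideal R} (hI : IsSemiregularIdeal R I) (hft : IsFiniteType R I) :
    LinearMap.id ∈ gvFiniteRank R I I := by
  obtain ⟨N, hN, hNI⟩ := isFiniteType_iff.1 hft
  obtain ⟨D, hD, hD', hDI⟩ := hI
  let I₀ : Ideal R := N.map (Submodule.subtype I) ⊔ D
  have hI₀ : I₀ ≤ I := sup_le (Submodule.map_subtype_le I N) hDI
  have hk : IsGVIso (Submodule.inclusion hI₀) := by
    refine ⟨?_, fun y => gvClosure_mono (fun x hx => ?_) (hNI y)⟩
    · rw [LinearMap.ker_eq_bot.2 (Submodule.inclusion_injective hI₀)]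
      exact bot_le
    · exact ⟨⟨x, le_sup_left (a := N.map (Submodule.subtype I)) ⟨x, hx, rfl⟩⟩, rfl⟩
  have htf : IsGVTorsionFree R I :=
    (isGVTorsionFree_self R).of_injective (Submodule.subtype I) Subtype.val_injective
  refine mem_gvFiniteRank_of_comp hk htf ?_
  exact gvFiniteRank_comp (hR I₀ ((hN.map _).sup hD) ⟨D, hD, hD', le_sup_right⟩)
    (Submodule.inclusion hI₀) LinearMap.id

/-- Induction along the filtration, from below: each step is an extension, and being of finite type
descends from a step to the previous one because the factor is of finite rank up to GV-torsion. -/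
theorem mkQ_mem_of_isSemiregularModule
    (hR : ∀ I : Ideal R, I.FG → IsSemiregularIdeal R I → LinearMap.id ∈ gvFiniteRank R I I)
    (hM : IsSemiregularModule R M) (hft : IsFiniteType R M) :
    (gvTor R M).mkQ ∈ gvFiniteRank R M (M ⧸ gvTor R M) := by
  obtain ⟨n, c, -, hc0, hcn, hc, hf⟩ := hM
  have key : ∀ i ≤ n, IsFiniteType R (c i) →
      (gvTor R (c i)).mkQ ∈ gvFiniteRank R (c i) (c i ⧸ gvTor R (c i)) := by
    intro i
    induction i with
    | zero =>
      intro _ _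
      have : Subsingleton (c 0) := by
        rw [hc0]
        infer_instance
      rw [Subsingleton.elim (gvTor R (c 0)).mkQ 0]
      exact zero_mem _
    | succ i ih =>
      intro hi hft
      obtain ⟨I, f, hI, hf⟩ := hf i hi
      rw [isWIso_iff] at hf
      let N := (c i).submoduleOf (c (i + 1))
      have hft' : IsFiniteType R (c (i + 1) ⧸ N) := hft.of_mem_closure_range N.mkQ fun y =>
        le_gvClosure _ (Submodule.mkQ_surjective N y)
      have hId := id_mem_gvFiniteRank_of_isFiniteType hR hI
        (hft'.of_mem_closure_range f hf.mem_closure)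
      have hq := mkQ_mem_of_isGVIso hf
        ((isGVTorsionFree_self R).of_injective (Submodule.subtype I) Subtype.val_injective)
        (gvFiniteRank_comp hId LinearMap.id f)
      have hle : c i ≤ c (i + 1) := hc i.le_succ
      have hinj := Submodule.inclusion_injective hle
      have hrange : LinearMap.range (Submodule.inclusion hle) = N := Submodule.range_inclusion _ _ _
      exact mkQ_mem_of_extension N hq _ hinj hrange
        (ih (Nat.le_of_succ_le hi) (hft.of_quotient N hq _ hinj hrange))
  have hbij : Function.Bijective (c n).subtype :=
    ⟨Subtype.val_injective, fun x => ⟨⟨x, by rw [hcn]; trivial⟩, rfl⟩⟩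
  let e := LinearEquiv.ofBijective _ hbij
  have h1 := key n le_rfl (hft.of_mem_closure_range e.symm.toLinearMap fun y =>
    le_gvClosure _ ⟨e y, e.symm_apply_apply y⟩)
  have htf := isGVTorsionFree_quotient_gvTor R M
  exact mem_gvFiniteRank_of_comp (isGVIso_of_bijective hbij) htf
    (mem_gvFiniteRank_of_mkQ_mem h1 htf _)

theorem isSemiregularModule_ideal {I : Ideal R} (hI : IsSemiregularIdeal R I) :
    IsSemiregularModule R I := by
  refine ⟨1, fun i => if i = 0 then ⊥ else ⊤, one_pos, by simp, by simp, ?_, ?_⟩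
  · intro i j hij
    by_cases hi : i = 0
    · simp [hi]
    · have hj : j ≠ 0 := by omega
      simp [hi, hj]
  · intro i hi
    obtain rfl : i = 0 := by omega
    let N : Submodule R (⊤ : Submodule R I) := (⊥ : Submodule R I).submoduleOf ⊤
    have hN : N = ⊥ := by
      rw [eq_bot_iff]
      intro x hx
      exact Subtype.ext hx
    let e : ((⊤ : Submodule R I) ⧸ N) ≃ₗ[R] I :=
      (Submodule.quotEquivOfEqBot N hN).trans Submodule.topEquiv
    exact ⟨I, e.toLinearMap, hI, isWIso_iff.2 (isGVIso_of_bijective e.bijective)⟩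

end FiniteType

/-! ### Global dimension -/

section Resolutions

open TensorProduct

/-- A free module and the kernel of its map onto `M` form a resolution of length one. -/
theorem srWWeakGlobalDim_le_one (h : ∀ (M : Type u) [AddCommGroup M] [Module R M], IsWFlat R M →
    ∀ N : Submodule R M, IsSrWFlat R N) : srWWeakGlobalDim R ≤ 1 := by
  refine iSup_le fun M => iInf₂_le_of_le 1 ?_ (by simp)
  let π : (M →₀ R) →ₗ[R] M := Finsupp.linearCombination R id
  have hπ : Function.Surjective π := Finsupp.linearCombination_id_surjective R _
  let F : ℕ → ModuleCat.{u} R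
    | 0 => ModuleCat.of R (M →₀ R)
    | 1 => ModuleCat.of R (LinearMap.ker π)
    | _ + 2 => ModuleCat.of R PUnit
  let d : ∀ i, F (i + 1) →ₗ[R] F i
    | 0 => (LinearMap.ker π).subtype
    | _ + 1 => 0
  have hd : ∀ i, Function.Injective (d i)
    | 0 => Subtype.val_injective
    | _ + 1 => fun (x y : PUnit) _ => Subsingleton.elim x y
  have hflat : IsWFlat R (M →₀ R) := isWFlat_of_flat
  refine ⟨F, d, π, isWEpi_iff.2 fun y => le_gvClosure _ (hπ y), isWExact_of_exact
    (LinearMap.exact_subtype_ker_map π), fun i => isWExact_of_exact fun x => ?_, fun i hi => ?_,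
    h _ hflat _, fun i hi => ?_⟩
  · constructor
    · intro hx
      exact ⟨0, by rw [map_zero, hd i (hx.trans (map_zero _).symm)]⟩
    · rintro ⟨y, rfl⟩
      exact map_zero _
  · obtain rfl : i = 0 := by omega
    exact hflat
  · obtain ⟨j, rfl⟩ : ∃ j, i = j + 2 := ⟨i - 2, by omega⟩
    exact inferInstanceAs (Subsingleton PUnit)

variable {A F₀ F₁ K M P : Type u} [AddCommGroup A] [Module R A] [AddCommGroup F₀] [Module R F₀]
  [AddCommGroup F₁] [Module R F₁] [AddCommGroup K] [Module R K] [AddCommGroup M] [Module R M]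
  [AddCommGroup P] [Module R P]

/-- Given exact sequences `0 → F₁ → F₀ → M → 0` and `0 → K → P → M → 0` with `F₀` flat, if
`A ⊗ F₁ → A ⊗ F₀` is injective, then so is `A ⊗ K → A ⊗ P`. As in Schanuel's lemma, this is seen
on the fibre product `X` of `F₀` and `P` over `M`. -/
theorem lTensor_injective_of_exact_of_exact [Module.Flat R F₀] {d : F₁ →ₗ[R] F₀} {ε : F₀ →ₗ[R] M}
    {k : K →ₗ[R] P} {p : P →ₗ[R] M} (h₁ : Function.Exact d ε) (hε : Function.Surjective ε)
    (hA : Function.Injective (d.lTensor A)) (h₂ : Function.Exact k p)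
    (hk : Function.Injective k) (hp : Function.Surjective p) :
    Function.Injective (k.lTensor A) := by
  let X : Submodule R (F₀ × P) :=
    LinearMap.ker (ε ∘ₗ LinearMap.fst R F₀ P - p ∘ₗ LinearMap.snd R F₀ P)
  have hX : ∀ x, x ∈ X ↔ ε x.1 = p x.2 := fun x => sub_eq_zero
  let α : F₁ →ₗ[R] X := (LinearMap.inl R F₀ P ∘ₗ d).codRestrict X fun f => by
    rw [hX]
    simp [h₁.apply_apply_eq_zero]
  let γ : K →ₗ[R] X := (LinearMap.inr R F₀ P ∘ₗ k).codRestrict X fun x => by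
    rw [hX]
    simp [h₂.apply_apply_eq_zero]
  let β : X →ₗ[R] P := LinearMap.snd R F₀ P ∘ₗ X.subtype
  let δ : X →ₗ[R] F₀ := LinearMap.fst R F₀ P ∘ₗ X.subtype
  have hβ : Function.Surjective β := by
    intro y
    obtain ⟨x, hx⟩ := hε (p y)
    exact ⟨⟨(x, y), (hX _).2 hx⟩, rfl⟩
  have hδ : Function.Surjective δ := by
    intro x
    obtain ⟨y, hy⟩ := hp (ε x)
    exact ⟨⟨(x, y), (hX _).2 hy.symm⟩, rfl⟩
  have hαβ : Function.Exact α β := by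
    rintro ⟨⟨x, y⟩, hxy⟩
    constructor
    · rintro (rfl : y = 0)
      obtain ⟨f, rfl⟩ := (h₁ x).1 (((hX _).1 hxy).trans (map_zero p))
      exact ⟨f, rfl⟩
    · rintro ⟨f, hf⟩
      exact (congrArg (fun z : X => z.1.2) hf).symm
  have hγδ : Function.Exact γ δ := by
    rintro ⟨⟨x, y⟩, hxy⟩
    constructor
    · rintro (rfl : x = 0)
      obtain ⟨f, rfl⟩ := (h₂ y).1 (((hX _).1 hxy).symm.trans (map_zero ε))
      exact ⟨f, rfl⟩
    · rintro ⟨f, hf⟩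
      exact (congrArg (fun z : X => z.1.1) hf).symm
  have hγ : Function.Injective γ := fun x y hxy => hk (congrArg (fun z : X => z.1.2) hxy)
  have hγA := LinearMap.lTensor_injective_of_exact_of_flat δ hδ γ hγ hγδ A
  rw [injective_iff_map_eq_zero] at *
  intro y hy
  obtain ⟨w, hw⟩ := (lTensor_exact A hαβ hβ (γ.lTensor A y)).1 (by
    rw [← LinearMap.comp_apply, ← LinearMap.lTensor_comp]
    exact hy)
  have hw0 : w = 0 := hA w (by
    have h3 := (lTensor_exact A hγδ hδ).apply_apply_eq_zero y
    rw [← hw, ← LinearMap.comp_apply, ← LinearMap.lTensor_comp] at h3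
    exact h3)
  rw [hw0, map_zero] at hw
  exact hγA y hw.symm

end Resolutions

section Localization

open TensorProduct

variable {X Y X' Y' M : Type u} [AddCommGroup X] [Module R X] [AddCommGroup Y] [Module R Y]
  [AddCommGroup X'] [Module R X'] [AddCommGroup Y'] [Module R Y'] [AddCommGroup M] [Module R M]

theorem isLocalizedModule_lTensor (S : Submonoid R) (g : X →ₗ[R] X') [IsLocalizedModule S g] :
    IsLocalizedModule S (g.lTensor M) := by
  have h1 : IsLocalizedModule S (g.rTensor M) :=
    inferInstanceAs (IsLocalizedModule S (AlgebraTensorModule.rTensor R M g))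
  have h2 := IsLocalizedModule.of_linearEquiv S (g.rTensor M) (TensorProduct.comm R X' M)
  have h3 := IsLocalizedModule.of_linearEquiv_right S
    ((TensorProduct.comm R X' M).toLinearMap ∘ₗ g.rTensor M) (TensorProduct.comm R M X)
  convert h3 using 1
  ext
  simp

theorem injective_of_isLocalizedModule (m : Ideal R) [m.IsPrime] (gX : X →ₗ[R] X')
    (gY : Y →ₗ[R] Y') [IsLocalizedModule m.primeCompl gX] [IsLocalizedModule m.primeCompl gY]
    {f : X →ₗ[R] Y} {f' : X' →ₗ[R] Y'} (hf : ∀ x, f' (gX x) = gY (f x))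
    (h : ∀ x, f x = 0 → ∃ s ∉ m, s • x = 0) : Function.Injective f' := by
  rw [injective_iff_map_eq_zero]
  intro t ht
  obtain ⟨⟨x, s⟩, hx⟩ := IsLocalizedModule.surj m.primeCompl gX t
  have hx' : s • t = gX x := hx
  have h1 : gY (f x) = 0 := by
    rw [← hf, ← hx', Submonoid.smul_def, map_smul, ht, smul_zero]
  obtain ⟨s', hs'⟩ := (IsLocalizedModule.eq_zero_iff m.primeCompl gY).1 h1
  rw [Submonoid.smul_def, ← map_smul] at hs'
  obtain ⟨s'', hs'', h''⟩ := h _ hs'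
  have h2 : gX x = 0 := (IsLocalizedModule.eq_zero_iff m.primeCompl gX).2
    ⟨⟨s'', hs''⟩ * s', by rw [mul_smul]; exact h''⟩
  rw [h2] at hx'
  exact IsLocalizedModule.smul_injective gX s (hx'.trans (smul_zero s).symm)

theorem exists_smul_eq_zero_of_isWMono {f : X →ₗ[R] Y} (hf : IsWMono f) {m : Ideal R}
    (hm : IsMaximalWIdeal R m) (x : X) (hx : f x = 0) : ∃ s ∉ m, s • x = 0 :=
  mem_gvClosure_iff_forall_isMaximalWIdeal.1 (isWMono_iff.1 hf hx) m hm

theorem IsWFlat.flat_localizedModule (h : IsWFlat R M) {m : Ideal R} [m.IsPrime]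
    (hm : IsMaximalWIdeal R m) : Module.Flat R (LocalizedModule m.primeCompl M) := by
  refine Module.Flat.iff_rTensor_injective.2 fun I _ => ?_
  have h1 := isLocalizedModule_lTensor (M := I) m.primeCompl
    (LocalizedModule.mkLinearMap m.primeCompl M)
  have h2 := isLocalizedModule_lTensor (M := R) m.primeCompl
    (LocalizedModule.mkLinearMap m.primeCompl M)
  refine injective_of_isLocalizedModule m
    ((LocalizedModule.mkLinearMap m.primeCompl M).lTensor I)
    ((LocalizedModule.mkLinearMap m.primeCompl M).lTensor R)
    (f := (Submodule.subtype I).rTensor M) (fun x => ?_)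
    (exists_smul_eq_zero_of_isWMono (h _ _ _ (isWMono_of_injective Subtype.val_injective)) hm)
  rw [← LinearMap.comp_apply, ← LinearMap.comp_apply, LinearMap.rTensor_comp_lTensor,
    LinearMap.lTensor_comp_rTensor]

theorem idealTensorMul_localizedModule_injective {I : Ideal R} {m : Ideal R} [m.IsPrime]
    (h : IsWMono (LinearMap.rTensor M (Submodule.subtype I))) (hm : IsMaximalWIdeal R m) :
    Function.Injective (idealTensorMul (LocalizedModule m.primeCompl M) I) := by
  have h1 := isLocalizedModule_lTensor (M := I) m.primeCompl
    (LocalizedModule.mkLinearMap m.primeCompl M)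
  refine injective_of_isLocalizedModule m
    ((LocalizedModule.mkLinearMap m.primeCompl M).lTensor I)
    (LocalizedModule.mkLinearMap m.primeCompl M) (f := idealTensorMul M I)
    (fun x => idealTensorMul_naturality I _ x) fun x hx => ?_
  refine exists_smul_eq_zero_of_isWMono h hm x ?_
  rw [← LinearMap.mem_ker, ← ker_idealTensorMul]
  exact hx

end Localization

section GlobalDimension

open TensorProduct

/-- A resolution of length `0` makes `R / I` semi-regular `w`-flat, so that `I = I²` locally. -/
theorem IsDenseIdeal.id_mem_of_resolution_zero {I : Ideal R} (hfg : I.FG) (hI : IsDenseIdeal R I)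
    (h : HasSrWFlatResolution R (R ⧸ I) 0) : LinearMap.id ∈ gvFiniteRank R I I := by
  have hfin : Module.Finite R I := Module.Finite.iff_fg.2 hfg
  obtain ⟨F, d, ε, hε, hex, -, -, hF, hsub⟩ := h
  have hF' := isSrWFlat_iff.1 hF I hfg ⟨I, hfg, hI, le_rfl⟩
  have : Subsingleton (F (0 + 1)) := hsub 1 one_pos
  refine hI.id_mem_gvFiniteRank_of_forall fun m hm => ?_
  have := hm.isPrime
  by_cases hIm : I ≤ m
  · have hε' := locMap_surjective_iff.1 (hε m hm)
    have hinj : ∀ x : F 0, ε x = 0 → ∃ s ∉ m, s • x = 0 := by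
      refine locMap_injective_iff.1 ?_
      rw [injective_iff_map_eq_zero]
      intro x hx
      obtain ⟨y, rfl⟩ := (hex m hm x).1 hx
      induction y using LocalizedModule.induction_on with
      | h b s =>
        rw [Subsingleton.elim b 0, LocalizedModule.zero_mk, map_zero]
    have hsq : ∀ a : I, ∃ s ∉ m, s • a ∈ m • (⊤ : Submodule R I) := by
      intro a
      obtain ⟨s, hs, e, he⟩ := hε' 1
      obtain ⟨s', hs', h'⟩ := hinj ((a : R) • e) (by
        rw [map_smul, he, smul_comm, ← Algebra.algebraMap_eq_smul_one,
          Ideal.Quotient.algebraMap_eq, Ideal.Quotient.eq_zero_iff_mem.2 a.2, smul_zero])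
      obtain ⟨s'', hs'', h''⟩ := exists_smul_eq_zero_of_isWMono hF' hm (s' • (a ⊗ₜ[R] e)) (by
        rw [← LinearMap.mem_ker, ← ker_idealTensorMul, LinearMap.mem_ker, map_smul,
          idealTensorMul_tmul, h'])
      refine ⟨s'' * s' * s, Ideal.IsPrime.mul_notMem inferInstance
        (Ideal.IsPrime.mul_notMem inferInstance hs'' hs') hs, ?_⟩
      refine Submodule.smul_mono hIm le_rfl ((quotient_one_tmul_eq_zero_iff I _).1 ?_)
      have h3 := congrArg ((TensorProduct.comm R I (R ⧸ I)).toLinearMap ∘ₗ ε.lTensor I) h''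
      simp only [LinearMap.comp_apply, map_smul, LinearMap.lTensor_tmul, he, map_zero,
        LinearEquiv.coe_coe, TensorProduct.comm_tmul] at h3
      rw [mul_smul, mul_smul, TensorProduct.tmul_smul, TensorProduct.tmul_smul,
        TensorProduct.tmul_smul]
      rwa [← TensorProduct.smul_tmul'] at h3
    obtain ⟨s, hs, hsx⟩ := exists_forall_smul_mem_of_finite m _ hsq
    obtain ⟨t, ht, htx⟩ := exists_forall_smul_eq_zero_of_smul_mem m hs hsx
    exact ⟨0, t, ht, fun b => by rw [htx]; exact zero_mem _⟩
  · obtain ⟨a, ha, ham⟩ := Set.not_subset.1 hIm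
    exact ⟨⟨a, ha⟩, a, ham, fun b => Submodule.mem_span_singleton.2 ⟨b, Subtype.ext (mul_comm _ _)⟩⟩

/-- A resolution of length `1` gives `Tor₂(R/I, R/I) = Tor₁(R/I, I) = 0` locally. -/
theorem isWMono_of_resolution_one {I : Ideal R} (hfg : I.FG) (hI : IsSemiregularIdeal R I)
    (h : HasSrWFlatResolution R (R ⧸ I) 1) :
    IsWMono (LinearMap.rTensor I (Submodule.subtype I)) := by
  obtain ⟨F, d, ε, hε, hex, hex', hF₀, hF, hsub⟩ := h
  have hF' := isSrWFlat_iff.1 hF I hfg hI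
  have : Subsingleton (F (0 + 1 + 1)) := hsub 2 one_lt_two
  rw [isWMono_iff, ← ker_idealTensorMul]
  intro z hz
  refine mem_gvClosure_iff_forall_isMaximalWIdeal.2 fun m hm => ?_
  have := hm.isPrime
  have := (hF₀ 0 one_pos).flat_localizedModule hm
  have hd : Function.Injective (locMap m (d 0)) := by
    rw [injective_iff_map_eq_zero]
    intro x hx
    obtain ⟨y, rfl⟩ := (hex' 0 m hm x).1 hx
    induction y using LocalizedModule.induction_on with
    | h b s =>
      rw [Subsingleton.elim b 0, LocalizedModule.zero_mk, map_zero]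
  have hdI : Function.Injective ((locMap m (d 0)).lTensor I) := by
    have hμ := idealTensorMul_localizedModule_injective hF' hm
    rw [injective_iff_map_eq_zero] at *
    intro w hw
    refine hμ w (hd _ ?_)
    rw [← idealTensorMul_naturality, hw, map_zero]
  have hexI : Function.Exact (locMap m (Submodule.subtype I)) (locMap m (Submodule.mkQ I)) :=
    IsLocalizedModule.map_exact m.primeCompl _ _ _ _ _ (LinearMap.exact_subtype_mkQ I)
  have hinj := lTensor_injective_of_exact_of_exact (A := I) (hex m hm) (hε m hm) hdI hexI
    (locMap_injective_iff.2 fun a ha => ⟨1, (Ideal.ne_top_iff_one m).1 ‹m.IsPrime›.ne_top, by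
      rw [one_smul]
      exact Subtype.ext ha⟩)
    (locMap_surjective_iff.2 fun b => ⟨1, (Ideal.ne_top_iff_one m).1 ‹m.IsPrime›.ne_top,
      by
        rw [one_smul]
        exact Submodule.mkQ_surjective I b⟩)
  have hz' : (Submodule.subtype I).lTensor I z = 0 := by
    have hR : Function.Injective (idealTensorMul R I) := (TensorProduct.lid R R).injective.comp
      (Module.Flat.rTensor_preserves_injective_linearMap _ Subtype.val_injective)
    rw [injective_iff_map_eq_zero] at hR
    refine hR _ ?_
    rw [idealTensorMul_naturality, LinearMap.mem_ker.1 hz, map_zero]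
  have hloc := isLocalizedModule_lTensor (M := I) m.primeCompl
    (LocalizedModule.mkLinearMap m.primeCompl I)
  have h0 : (LocalizedModule.mkLinearMap m.primeCompl I).lTensor I z = 0 := by
    refine (injective_iff_map_eq_zero _).1 hinj _ ?_
    have hcomp : locMap m (Submodule.subtype I) ∘ₗ LocalizedModule.mkLinearMap m.primeCompl I =
        LocalizedModule.mkLinearMap m.primeCompl R ∘ₗ Submodule.subtype I :=
      IsLocalizedModule.map_comp _ _ _ _
    rw [← LinearMap.comp_apply, ← LinearMap.lTensor_comp, hcomp, LinearMap.lTensor_comp,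
      LinearMap.comp_apply, hz', map_zero]
  obtain ⟨s, hs⟩ := (IsLocalizedModule.eq_zero_iff m.primeCompl _).1 h0
  exact ⟨s, s.2, hs⟩

theorem IsDenseIdeal.id_mem_of_srWWeakGlobalDim_le_one (h : srWWeakGlobalDim R ≤ 1) {I : Ideal R}
    (hfg : I.FG) (hI : IsDenseIdeal R I) : LinearMap.id ∈ gvFiniteRank R I I := by
  have h1 : srWFlatDim R (R ⧸ I) < 2 :=
    ((le_iSup (fun M : ModuleCat.{u} R => srWFlatDim R M) (ModuleCat.of R (R ⧸ I))).trans
      h).trans_lt (by norm_num)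
  obtain ⟨n, hn⟩ := iInf_lt_iff.1 h1
  obtain ⟨hres, hn⟩ := iInf_lt_iff.1 hn
  have hn2 : n < 2 := by exact_mod_cast hn
  interval_cases n
  · exact hI.id_mem_of_resolution_zero hfg hres
  · exact hI.id_mem_gvFiniteRank_of_isWMono hfg
      (isWMono_of_resolution_one hfg ⟨I, hfg, hI, le_rfl⟩ hres)

end GlobalDimension

end WModule

open WModule in
theorem theorem4p4 (R : Type u) [CommRing R] :
    List.TFAE [
      -- `R` is a `Q₀`-PvMR
      IsQ0PvMR R,
      -- the same with `w`-invertibility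
      ∀ I : Ideal R, I.FG → IsSemiregularIdeal R I → IsWInvertible I,
      -- submodules of semi-regular `w`-flat modules
      ∀ (M : Type u) [AddCommGroup M] [Module R M], IsSrWFlat R M →
        ∀ N : Submodule R M, IsSrWFlat R N,
      -- submodules of `w`-flat modules
      ∀ (M : Type u) [AddCommGroup M] [Module R M], IsWFlat R M →
        ∀ N : Submodule R M, IsSrWFlat R N,
      -- ideals
      ∀ I : Ideal R, IsSrWFlat R I,
      ∀ I : Ideal R, I.FG → IsSrWFlat R I,
      ∀ I : Ideal R, IsFiniteType R I → IsSrWFlat R I,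
      -- semi-regular ideals
      ∀ I : Ideal R, I.FG → IsSemiregularIdeal R I → IsWFlat R I,
      ∀ I : Ideal R, IsFiniteType R I → IsSemiregularIdeal R I → IsWFlat R I,
      ∀ I : Ideal R, I.FG → IsSemiregularIdeal R I → IsWProjective R I,
      ∀ I : Ideal R, IsFiniteType R I → IsSemiregularIdeal R I → IsWProjective R I,
      -- global dimension
      srWWeakGlobalDim R ≤ 1,
      -- semi-regular modules
      ∀ (M : Type u) [AddCommGroup M] [Module R M], Module.Finite R M →
        IsSemiregularModule R M → IsWProjective R M,
      ∀ (M : Type u) [AddCommGroup M] [Module R M], IsFiniteType R M →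
        IsSemiregularModule R M → IsWProjective R M] := by
  -- `w`-invertibility is finite rank of the identity up to GV-ideals
  have id_of_2 : (∀ I : Ideal R, I.FG → IsSemiregularIdeal R I → IsWInvertible I) →
      ∀ I : Ideal R, I.FG → IsSemiregularIdeal R I → LinearMap.id ∈ gvFiniteRank R I I :=
    fun h I h₁ h₂ => (isWInvertible_iff_id_mem h₁ h₂.isDenseIdeal).1 (h I h₁ h₂)
  have of_id : (∀ I : Ideal R, I.FG → IsSemiregularIdeal R I →
      LinearMap.id ∈ gvFiniteRank R I I) →
      ∀ I : Ideal R, I.FG → IsSemiregularIdeal R I → IsWInvertible I :=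
    fun h I h₁ h₂ => (isWInvertible_iff_id_mem h₁ h₂.isDenseIdeal).2 (h I h₁ h₂)
  have ft : ∀ I : Ideal R, I.FG → IsFiniteType R I := fun I h => by
    have : Module.Finite R I := Module.Finite.iff_fg.2 h
    exact isFiniteType_of_finite
  tfae_have 1 ↔ 2 := isQ0PvMR_iff_isWInvertible
  tfae_have 2 → 3 := fun h M _ _ hM N =>
    hM.submodule (fun I h₁ h₂ => isWFlat_of_id_mem (id_of_2 h I h₁ h₂)) N
  tfae_have 3 → 4 := fun h M _ _ hM N => h M hM.isSrWFlat N
  tfae_have 4 → 5 := fun h I => h R isWFlat_of_flat I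
  tfae_have 5 → 7 := fun h I _ => h I
  tfae_have 7 → 6 := fun h I h₁ => h I (ft I h₁)
  tfae_have 6 → 2 := fun h => of_id fun I h₁ h₂ =>
    h₂.isDenseIdeal.id_mem_gvFiniteRank_of_isWMono h₁ (isSrWFlat_iff.1 (h I h₁) I h₁ h₂)
  tfae_have 2 → 9 := fun h I h₁ h₂ =>
    isWFlat_of_id_mem (id_mem_gvFiniteRank_of_isFiniteType (id_of_2 h) h₂ h₁)
  tfae_have 9 → 8 := fun h I h₁ h₂ => h I (ft I h₁) h₂
  tfae_have 8 → 2 := fun h => of_id fun I h₁ h₂ =>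
    h₂.isDenseIdeal.id_mem_gvFiniteRank_of_isWMono h₁
      (h I h₁ h₂ _ _ _ (isWMono_of_injective Subtype.val_injective))
  tfae_have 4 → 12 := srWWeakGlobalDim_le_one
  tfae_have 12 → 2 := fun h => of_id fun I h₁ h₂ =>
    h₂.isDenseIdeal.id_mem_of_srWWeakGlobalDim_le_one h h₁
  tfae_have 2 → 14 := fun h M _ _ h₁ h₂ =>
    isWProjective_of_mkQ_mem (mkQ_mem_of_isSemiregularModule (id_of_2 h) h₂ h₁)
  tfae_have 14 → 13 := fun h M _ _ _ h₂ => h M isFiniteType_of_finite h₂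
  tfae_have 14 → 11 := fun h I h₁ h₂ => h I h₁ (isSemiregularModule_ideal h₂)
  tfae_have 13 → 10 := fun h I h₁ h₂ =>
    h I (Module.Finite.iff_fg.2 h₁) (isSemiregularModule_ideal h₂)
  tfae_have 11 → 10 := fun h I h₁ h₂ => h I (ft I h₁) h₂
  tfae_have 10 → 2 := fun h => of_id fun I h₁ h₂ => by
    have : Module.Finite R I := Module.Finite.iff_fg.2 h₁
    exact mem_gvFiniteRank_of_mkQ_mem (h I h₁ h₂).mkQ_mem
      ((isGVTorsionFree_self R).of_injective (Submodule.subtype I) Subtype.val_injective) _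
  tfae_finish
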